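/- Let $n\ge k\ge 0$ be integers, let $\mathrm{SU}(2)$ act diagonally on the space $\mathcal H=(\mathbb C^2)^{\otimes 2n}$ of $2n$ qubits, let $N$ be the dimension of the subspace of $\mathrm{SU}(2)$-invariant vectors, and let $\rho=\frac1N P$, where $P$ is the orthogonal projection onto this subspace (the maximally mixed invariant state). Split the $2n$ qubits into a group $A$ of $2k$ qubits and the group $B$ of the remaining $2n-2k$ qubits, so that $\mathcal H=\mathcal H_A\otimes\mathcal H_B$. Let $d^A_j$ and $d^B_j$ be the multiplicities of the spin-$j$ irreducible representation $V^j$ of $\mathrm{SU}(2)$ in $\mathcal H_A$ and $\mathcal H_B$. With $S(\sigma)=-\operatorname{tr}\sigma\log\sigma$ (natural logarithm), the entanglement of formation of $\rho$ is $$E(\rho)=\min\sum_i w_i\,S\big(\operatorname{tr}_B|\Psi_i\rangle\langle\Psi_i|\big),$$ the minimum being over all finite decompositions $\rho=\sum_i w_i|\Psi_i\rangle\langle\Psi_i|$ with unit vectors $\Psi_i$, $w_i>0$, $\sum_i w_i=1$. Then this minimum is attained. Moreover, angular momentum bases $|j,m,a_j\rangle$ of $\mathcal H_A$ and $|j,m,b_j\rangle$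 of $\mathcal H_B$ exist (orthonormal bases with $j=0,1,2,\dots$, $-j\le m\le j$, $1\le a_j\le d^A_j$, $1\le b_j\le d^B_j$, on which $J_z$ acts by $m$ and $J_\pm$ sends $|j,m,\cdot\rangle$ to $\sqrt{(j\mp m)(j\pm m+1)}\,|j,m\pm1,\cdot\rangle$). For any such bases put $$|j,a_j,b_j\rangle=\frac1{\sqrt{2j+1}}\sum_{m=-j}^{j}(-1)^{j-m}|j,-m,a_j\rangle\otimes|j,m,b_j\rangle .$$ Then the reduced density matrix $\rho_{j,a_j}=\operatorname{tr}_B|j,a_j,b_j\rangle\langle j,a_j,b_j|$ does not depend on $b_j$, and $$E(\rho)=\frac1N\sum_{j=0}^{k}\sum_{a_j=1}^{d^A_j}d^B_j\,S(\rho_{j,a_j})=\frac1N\sum_{j=0}^{k}d^A_j\,d^B_j\,\log(2j+1),$$ where terms with $d^B_j=0$ are zero. -/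

import Mathlib

open scoped Matrix

noncomputable section

/-- The Hilbert space `(ℂ²)^{⊗ ι}` of the qubits labelled by `ι`. A vector is given by its amplitudes
in the computational basis `ι → Fin 2`; the value `0` stands for spin up, `1` for spin down. -/
abbrev Qubits (ι : Type) [Fintype ι] : Type := EuclideanSpace ℂ (ι → Fin 2)

/-! ### The action of SU(2) -/

/-- The tensor power `U^{⊗ ι}` of a `2 × 2` matrix. -/
def tensorPow (ι : Type) [Fintype ι] (U : Matrix (Fin 2) (Fin 2) ℂ) :
    Matrix (ι → Fin 2) (ι → Fin 2) ℂ :=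
  Matrix.of fun x y => ∏ i, U (x i) (y i)

theorem tensorPow_one (ι : Type) [Fintype ι] [DecidableEq ι] : tensorPow ι 1 = 1 := by
  ext x y
  simp only [tensorPow, Matrix.of_apply, Matrix.one_apply]
  by_cases h : x = y
  · simp [h]
  · rw [if_neg h]
    obtain ⟨i, hi⟩ := Function.ne_iff.1 h
    exact Finset.prod_eq_zero (Finset.mem_univ i) (if_neg hi)

theorem tensorPow_mul (ι : Type) [Fintype ι] [DecidableEq ι] (U V : Matrix (Fin 2) (Fin 2) ℂ) :
    tensorPow ι (U * V) = tensorPow ι U * tensorPow ι V := by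
  ext x y
  simp only [tensorPow, Matrix.of_apply, Matrix.mul_apply, ← Finset.prod_mul_distrib]
  rw [Finset.prod_univ_sum, Fintype.piFinset_univ]

/-- The unitary representation `g ↦ g^{⊗ ι}` of `SU(2)` on the qubits labelled by `ι`. -/
def qubitRep (ι : Type) [Fintype ι] [DecidableEq ι] :
    Representation ℂ (Matrix.specialUnitaryGroup (Fin 2) ℂ) (Qubits ι) where
  toFun g := Matrix.toEuclideanLin (tensorPow ι (g : Matrix (Fin 2) (Fin 2) ℂ))
  map_one' := by
    ext v x
    simp [tensorPow_one]
  map_mul' g h := by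
    ext v x
    simp [tensorPow_mul, Matrix.mulVec_mulVec]

/-- The `SU(2)`-invariant vectors (the intertwiner space). -/
abbrev singletSpace (ι : Type) [Fintype ι] [DecidableEq ι] : Submodule ℂ (Qubits ι) :=
  (qubitRep ι).invariants

/-- The symmetric tensors of `2j` qubits, as a subrepresentation. -/
def symmetricQubits (j : ℕ) : Subrepresentation (qubitRep (Fin (2 * j))) where
  toSubmodule :=
    { carrier := {v | ∀ (s : Equiv.Perm (Fin (2 * j))) (x : Fin (2 * j) → Fin 2), v (x ∘ s) = v x}
      zero_mem' := fun _ _ => rfl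
      add_mem' := fun {v w} hv hw s x => by simp [hv s x, hw s x]
      smul_mem' := fun c v hv s x => by simp [hv s x] }
  apply_mem_toSubmodule g v hv := by
    intro s x
    change ∑ y, tensorPow _ _ (x ∘ s) y * v y = ∑ y, tensorPow _ _ x y * v y
    refine (Fintype.sum_equiv (s.arrowCongr (Equiv.refl (Fin 2))).symm _ _ ?_).symm
    intro y
    have hy : (s.arrowCongr (Equiv.refl (Fin 2))).symm y = y ∘ s := by
      ext i
      simp [Equiv.arrowCongr]
    rw [hy, hv s y]
    congr 1
    simp only [tensorPow, Matrix.of_apply, Function.comp_apply]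
    exact (Equiv.prod_comp s
      (fun i => (g : Matrix (Fin 2) (Fin 2) ℂ) (x i) (y i))).symm

/-- The spin-`j` irreducible representation `V^j` of `SU(2)` (`j` an integer), realized as the
symmetric power `Sym^{2j}(ℂ²)`; it has dimension `2j + 1`. -/
def spinRep (j : ℕ) :
    Representation ℂ (Matrix.specialUnitaryGroup (Fin 2) ℂ) (symmetricQubits j).toSubmodule :=
  (symmetricQubits j).toRepresentation

/-- The multiplicity `d_j` of the spin-`j` irreducible representation in the qubits labelled by `ι`:
the dimension of the space of `SU(2)`-equivariant linear maps `V^j → (ℂ²)^{⊗ ι}`. -/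
def spinMult (ι : Type) [Fintype ι] [DecidableEq ι] (j : ℕ) : ℕ :=
  Module.finrank ℂ (Representation.IntertwiningMap (spinRep j) (qubitRep ι))

/-! ### Angular momentum bases -/

/-- The collective operator `∑ i, s^{(i)}`, where `s^{(i)}` is the one-qubit operator `s` acting on
qubit `i`. -/
def collective {ι : Type} [Fintype ι] [DecidableEq ι] (s : Matrix (Fin 2) (Fin 2) ℂ)
    (v : Qubits ι) : Qubits ι :=
  WithLp.toLp 2 fun x => ∑ i, ∑ c, s (x i) c * v (Function.update x i c)

/-- The total angular momentum component `J_z` (with `ħ = 1`). -/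
def angJz {ι : Type} [Fintype ι] [DecidableEq ι] (v : Qubits ι) : Qubits ι :=
  collective !![1 / 2, 0; 0, -1 / 2] v

/-- The raising operator `J_+ = J_x + i J_y`. -/
def angJplus {ι : Type} [Fintype ι] [DecidableEq ι] (v : Qubits ι) : Qubits ι :=
  collective !![0, 1; 0, 0] v

/-- The lowering operator `J_- = J_x - i J_y`. -/
def angJminus {ι : Type} [Fintype ι] [DecidableEq ι] (v : Qubits ι) : Qubits ι :=
  collective !![0, 0; 1, 0] v

/-- `e` is an angular momentum basis `|j, m, a⟩` of an even number of qubits, `a` running over the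
`d_j` copies of spin `j`. The last index is `μ = j + m ∈ {0, …, 2j}` instead of `m ∈ {-j, …, j}`.
The conditions are: orthonormality, completeness, `J_z |j,m,a⟩ = m |j,m,a⟩` and
`J_± |j,m,a⟩ = √((j ∓ m)(j ± m + 1)) |j,m±1,a⟩`, the right-hand side being `0` at the ends. -/
structure IsAngularMomentumBasis {ι : Type} [Fintype ι] [DecidableEq ι]
    (e : (j : ℕ) → Fin (spinMult ι j) → Fin (2 * j + 1) → Qubits ι) : Prop where
  orthonormal : Orthonormal ℂ
    (fun p : (j : ℕ) × (Fin (spinMult ι j) × Fin (2 * j + 1)) => e p.1 p.2.1 p.2.2)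
  span_eq_top : Submodule.span ℂ (Set.range
    (fun p : (j : ℕ) × (Fin (spinMult ι j) × Fin (2 * j + 1)) => e p.1 p.2.1 p.2.2)) = ⊤
  jz : ∀ j a (μ : Fin (2 * j + 1)), angJz (e j a μ) = ((μ : ℂ) - (j : ℂ)) • e j a μ
  jplus_last : ∀ j a, angJplus (e j a (Fin.last (2 * j))) = 0
  jplus : ∀ j a (μ : Fin (2 * j)), angJplus (e j a μ.castSucc) =
    ((Real.sqrt ((2 * (j : ℝ) - (μ : ℝ)) * ((μ : ℝ) + 1)) : ℝ) : ℂ) • e j a μ.succ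
  jminus_zero : ∀ j a, angJminus (e j a 0) = 0
  jminus : ∀ j a (μ : Fin (2 * j)), angJminus (e j a μ.succ) =
    ((Real.sqrt ((2 * (j : ℝ) - (μ : ℝ)) * ((μ : ℝ) + 1)) : ℝ) : ℂ) • e j a μ.castSucc

/-! ### Bipartite splittings, states, entanglement -/

/-- The qubits of block `A`. -/
abbrev BlockA {ι : Type} (S : Finset ι) : Type := {i : ι // i ∈ S}

/-- The remaining qubits, which form block `B`. -/
abbrev BlockB {ι : Type} (S : Finset ι) : Type := {i : ι // ¬ i ∈ S}

/-- The identification of pairs of configurations of the two blocks with configurations of all the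
qubits; it is the identification `H_A ⊗ H_B = H` in the computational bases. -/
def glue {ι : Type} [DecidableEq ι] (S : Finset ι) :
    (BlockA S → Fin 2) × (BlockB S → Fin 2) ≃ (ι → Fin 2) :=
  (Equiv.piEquivPiSubtypeProd (fun i => i ∈ S) (fun _ => Fin 2)).symm

/-- The product vector `v ⊗ w`. -/
def prodVec {ι : Type} [Fintype ι] [DecidableEq ι] (S : Finset ι)
    (v : Qubits (BlockA S)) (w : Qubits (BlockB S)) : Qubits ι :=
  WithLp.toLp 2 fun x => v ((glue S).symm x).1 * w ((glue S).symm x).2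

/-- The matrix of `|ψ⟩⟨ψ|`. -/
def pureState {ι : Type} [Fintype ι] (ψ : Qubits ι) : Matrix (ι → Fin 2) (ι → Fin 2) ℂ :=
  Matrix.vecMulVec (WithLp.ofLp ψ) (star (WithLp.ofLp ψ))

/-- The partial trace over block `B`. -/
def traceB {ι : Type} [Fintype ι] [DecidableEq ι] (S : Finset ι)
    (M : Matrix (ι → Fin 2) (ι → Fin 2) ℂ) :
    Matrix (BlockA S → Fin 2) (BlockA S → Fin 2) ℂ :=
  Matrix.of fun x x' => ∑ y, M (glue S (x, y)) (glue S (x', y))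

/-- The von Neumann entropy `-tr (M log M)` of a density matrix (natural logarithm). -/
def vonNeumannEntropy {m : Type} [Fintype m] [DecidableEq m] (M : Matrix m m ℂ) : ℝ :=
  (-(M * cfc Real.log M).trace).re

/-- The degree of entanglement of a pure state: the entropy of its reduced density matrix. -/
def pureEntanglement {ι : Type} [Fintype ι] [DecidableEq ι] (S : Finset ι) (ψ : Qubits ι) : ℝ :=
  vonNeumannEntropy (traceB S (pureState ψ))

/-- The weighted averages of the degrees of entanglement, over all the decompositions of `ρ` into
finite mixtures of pure states. -/
def averageEntanglements {ι : Type} [Fintype ι] [DecidableEq ι] (S : Finset ι)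
    (ρ : Matrix (ι → Fin 2) (ι → Fin 2) ℂ) : Set ℝ :=
  {t | ∃ (r : ℕ) (w : Fin r → ℝ) (ψ : Fin r → Qubits ι),
    (∀ i, 0 < w i) ∧ ∑ i, w i = 1 ∧ (∀ i, ‖ψ i‖ = 1) ∧
    ρ = ∑ i, (w i : ℂ) • pureState (ψ i) ∧
    t = ∑ i, w i * pureEntanglement S (ψ i)}

/-- The entanglement of formation of `ρ` for the splitting of the qubits into `S` and its
complement. -/
def entanglementOfFormation {ι : Type} [Fintype ι] [DecidableEq ι] (S : Finset ι)
    (ρ : Matrix (ι → Fin 2) (ι → Fin 2) ℂ) : ℝ :=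
  sInf (averageEntanglements S ρ)

/-- The maximally mixed state on the `SU(2)`-invariant subspace: the orthogonal projection onto it,
divided by its dimension. -/
def singletState (ι : Type) [Fintype ι] [DecidableEq ι] : Matrix (ι → Fin 2) (ι → Fin 2) ℂ :=
  ((Module.finrank ℂ (singletSpace ι) : ℂ))⁻¹ •
    Matrix.toEuclideanLin.symm ((singletSpace ι).starProjection : Qubits ι →ₗ[ℂ] Qubits ι)

/-- The singlet built on one copy of spin `j` in each block:
`|j,a,b⟩ = (2j+1)^{-1/2} ∑ m, (-1)^{j-m} |j,-m,a⟩ ⊗ |j,m,b⟩`, where `u μ = |j,m,a⟩` and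
`v μ = |j,m,b⟩` for `μ = j + m`; so `-m` corresponds to `2j - μ`, and `(-1)^{j-m} = (-1)^μ`. -/
def spinSinglet {ι : Type} [Fintype ι] [DecidableEq ι] (S : Finset ι) (j : ℕ)
    (u : Fin (2 * j + 1) → Qubits (BlockA S)) (v : Fin (2 * j + 1) → Qubits (BlockB S)) :
    Qubits ι :=
  ((Real.sqrt (2 * (j : ℝ) + 1) : ℝ) : ℂ)⁻¹ •
    ∑ μ : Fin (2 * j + 1), ((-1 : ℂ) ^ (μ : ℕ)) • prodVec S (u μ.rev) (v μ)

end

/-! By Clebsch–Gordan, a spin-`j` multiplet of `A` and a spin-`j'` multiplet of `B` contain an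
invariant vector only if `j = j'`, and then exactly one up to scalars. So the vectors `|j,a,b⟩` form
an orthonormal basis of the invariant subspace, and `ρ` is their uniform mixture
(`singletState_eq_sum`). The reduced matrix of `|j,a,b⟩` is maximally mixed on a space of dimension
`2j+1`, with entropy `log (2j+1)`; this mixture gives the upper bound.

For the lower bound, every vector of a decomposition lies in the support of `ρ`, hence is invariant.
Let `ψ` be an invariant unit vector with coefficients `c_{jab}`. Contracting it with `|j,m,a⟩`
gives, up to sign, `(2j+1)^{-1/2} ∑_b conj-free c_{jab} |j,-m,b⟩`. Hence the reduced matrix is block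
diagonal in `(j,m)`, and each of the `2j+1` blocks of spin `j` has trace at most `1/(2j+1)`. An
eigenvector that meets spin `j` therefore has eigenvalue at most `1/(2j+1)` (`eigenvalue_le`), and
the entropy is at least `∑ |c_{jab}|² log (2j+1)` (`le_vonNeumannEntropy`, `le_pureEntanglement`).
This bound is linear in `|ψ⟩⟨ψ|`, so its average depends on `ρ` alone: each `|j,a,b⟩` receives total
weight `1/N` (`isLeast_averageEntanglements`).

The representation theory reduces to ladder operators. Actions of `SU(2)` and of `J_z, J_±`
determine each other along one-parameter groups (`intertwines_of_collective`,
`collective_of_intertwines`). Thus the multiplicity of `V^j` is the dimension of the space of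
highest weight vectors (`finrank_highestWeight`), lowering these vectors gives angular momentum
bases (`exists_isAngularMomentumBasis`), and Schur's lemma becomes a recursion on coefficients
(`coeff_of_ne`, `coeff_eq_ite`). -/

set_option linter.unusedSectionVars false

noncomputable section

/-! ### Collective one-qubit operators and the angular momentum relations -/

section CollectiveOperators

variable {ι : Type} [Fintype ι] [DecidableEq ι]

/-- The one-qubit operator `s` acting on qubit `i`. -/
def siteOp (i : ι) (s : Matrix (Fin 2) (Fin 2) ℂ) : Qubits ι →ₗ[ℂ] Qubits ι where
  toFun v := WithLp.toLp 2 fun x => ∑ c, s (x i) c * v (Function.update x i c)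
  map_add' v w := by
    ext x
    simp [mul_add, Finset.sum_add_distrib]
  map_smul' r v := by
    ext x
    simp [mul_add]
    ring

theorem siteOp_apply (i : ι) (s : Matrix (Fin 2) (Fin 2) ℂ) (v : Qubits ι) (x : ι → Fin 2) :
    siteOp i s v x = ∑ c, s (x i) c * v (Function.update x i c) := rfl

theorem siteOp_mul (i : ι) (s t : Matrix (Fin 2) (Fin 2) ℂ) (v : Qubits ι) :
    siteOp i s (siteOp i t v) = siteOp i (s * t) v := by
  ext x
  simp only [siteOp_apply, Function.update_self, Function.update_idem, Matrix.mul_apply,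
    Finset.sum_mul, Finset.mul_sum]
  rw [Finset.sum_comm]
  simp only [mul_assoc]

theorem siteOp_comm {i j : ι} (h : i ≠ j) (s t : Matrix (Fin 2) (Fin 2) ℂ) (v : Qubits ι) :
    siteOp i s (siteOp j t v) = siteOp j t (siteOp i s v) := by
  ext x
  simp only [siteOp_apply, Function.update_of_ne h, Function.update_of_ne h.symm,
    Finset.mul_sum]
  rw [Finset.sum_comm]
  refine Finset.sum_congr rfl fun c _ => Finset.sum_congr rfl fun d _ => ?_
  rw [Function.update_comm h]
  ring

/-- The collective operator as a linear map, linear in the one-qubit operator. -/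
def collectiveHom (ι : Type) [Fintype ι] [DecidableEq ι] :
    Matrix (Fin 2) (Fin 2) ℂ →ₗ[ℂ] Qubits ι →ₗ[ℂ] Qubits ι where
  toFun s := ∑ i, siteOp i s
  map_add' s t := by
    ext v x
    simp [siteOp_apply, add_mul, Finset.sum_add_distrib]
  map_smul' r s := by
    ext v x
    simp only [LinearMap.sum_apply, WithLp.ofLp_sum, Finset.sum_apply, siteOp_apply,
      Matrix.smul_apply, smul_eq_mul, mul_assoc, RingHom.id_apply, LinearMap.smul_apply,
      PiLp.smul_apply, Finset.mul_sum]

theorem collectiveHom_eq_sum (s : Matrix (Fin 2) (Fin 2) ℂ) :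
    collectiveHom ι s = ∑ i, siteOp i s := rfl

theorem collectiveHom_apply (s : Matrix (Fin 2) (Fin 2) ℂ) (v : Qubits ι) :
    collectiveHom ι s v = collective s v := by
  ext x
  simp [collectiveHom_eq_sum, collective, siteOp_apply]

theorem collective_apply (s : Matrix (Fin 2) (Fin 2) ℂ) (v : Qubits ι) (x : ι → Fin 2) :
    collective s v x = ∑ i, ∑ c, s (x i) c * v (Function.update x i c) := rfl

/-- Operators on different qubits commute, so only the terms acting twice on the same qubit survive.
All the relations between `J_z`, `J_+` and `J_-` thereby reduce to `2 × 2` matrices. -/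
theorem collective_commutator (s t : Matrix (Fin 2) (Fin 2) ℂ) (v : Qubits ι) :
    collective s (collective t v) - collective t (collective s v) =
      collective (s * t - t * s) v := by
  simp only [← collectiveHom_apply, map_sub, LinearMap.sub_apply]
  simp only [collectiveHom_eq_sum, LinearMap.sum_apply, map_sum]
  rw [Finset.sum_comm, ← Finset.sum_sub_distrib, ← Finset.sum_sub_distrib]
  refine Finset.sum_congr rfl fun i _ => ?_
  rw [← Finset.sum_sub_distrib, Finset.sum_eq_single i]
  · rw [siteOp_mul, siteOp_mul]
  · intro j _ hj
    rw [siteOp_comm hj.symm, sub_self]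
  · simp

theorem inner_siteOp (i : ι) (s : Matrix (Fin 2) (Fin 2) ℂ) (v w : Qubits ι) :
    inner ℂ (siteOp i s v) w = inner ℂ v (siteOp i sᴴ w) := by
  simp only [PiLp.inner_apply, siteOp_apply, RCLike.inner_apply, map_sum, map_mul, Finset.mul_sum,
    Finset.sum_mul, ← Fintype.sum_prod_type']
  -- The involution that exchanges the value of qubit `i` with the summation variable turns the row
  -- index of `s` into a column index.
  refine Finset.sum_nbij' (fun p : (ι → Fin 2) × Fin 2 => (Function.update p.1 i p.2, p.1 i))
    (fun p => (Function.update p.1 i p.2, p.1 i)) (by simp) (by simp) (by simp) (by simp) ?_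
  rintro ⟨x, c⟩ -
  simp only [Function.update_self, Function.update_idem, Function.update_eq_self,
    Matrix.conjTranspose_apply, starRingEnd_apply]
  ring

theorem inner_collective (s : Matrix (Fin 2) (Fin 2) ℂ) (v w : Qubits ι) :
    inner ℂ (collective s v) w = inner ℂ v (collective sᴴ w) := by
  simp only [← collectiveHom_apply, collectiveHom_eq_sum, LinearMap.sum_apply, sum_inner, inner_sum,
    inner_siteOp]

/-- `J_z` as a linear map. -/
def jzHom (ι : Type) [Fintype ι] [DecidableEq ι] : Qubits ι →ₗ[ℂ] Qubits ι :=
  collectiveHom ι !![1 / 2, 0; 0, -1 / 2]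

/-- `J_+` as a linear map. -/
def jplusHom (ι : Type) [Fintype ι] [DecidableEq ι] : Qubits ι →ₗ[ℂ] Qubits ι :=
  collectiveHom ι !![0, 1; 0, 0]

/-- `J_-` as a linear map. -/
def jminusHom (ι : Type) [Fintype ι] [DecidableEq ι] : Qubits ι →ₗ[ℂ] Qubits ι :=
  collectiveHom ι !![0, 0; 1, 0]

theorem angJz_eq (v : Qubits ι) : angJz v = jzHom ι v := (collectiveHom_apply _ _).symm

theorem angJplus_eq (v : Qubits ι) : angJplus v = jplusHom ι v := (collectiveHom_apply _ _).symm

theorem angJminus_eq (v : Qubits ι) : angJminus v = jminusHom ι v := (collectiveHom_apply _ _).symm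

theorem jz_jplus (v : Qubits ι) :
    jzHom ι (jplusHom ι v) = jplusHom ι (jzHom ι v) + jplusHom ι v := by
  rw [← sub_eq_iff_eq_add']
  simp only [jzHom, jplusHom, collectiveHom_apply, collective_commutator]
  congr 1
  ext i j
  fin_cases i <;> fin_cases j <;> simp
  norm_num

theorem jz_jminus (v : Qubits ι) :
    jzHom ι (jminusHom ι v) = jminusHom ι (jzHom ι v) - jminusHom ι v := by
  rw [sub_eq_add_neg, ← sub_eq_iff_eq_add', ← LinearMap.neg_apply, jminusHom, ← map_neg]
  simp only [jzHom, collectiveHom_apply, collective_commutator]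
  congr 1
  ext i j
  fin_cases i <;> fin_cases j <;> simp
  norm_num

theorem jplus_jminus (v : Qubits ι) :
    jplusHom ι (jminusHom ι v) = jminusHom ι (jplusHom ι v) + (2 : ℂ) • jzHom ι v := by
  rw [← sub_eq_iff_eq_add', ← LinearMap.smul_apply, jzHom, ← map_smul]
  simp only [jminusHom, jplusHom, collectiveHom_apply, collective_commutator]
  congr 1
  ext i j
  fin_cases i <;> fin_cases j <;> simp
  norm_num

theorem inner_jz (v w : Qubits ι) : inner ℂ (jzHom ι v) w = inner ℂ v (jzHom ι w) := by
  simp only [jzHom, collectiveHom_apply, inner_collective]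
  congr 2
  ext i j
  fin_cases i <;> fin_cases j <;> simp

theorem inner_jminus (v w : Qubits ι) :
    inner ℂ (jminusHom ι v) w = inner ℂ v (jplusHom ι w) := by
  simp only [jminusHom, jplusHom, collectiveHom_apply, inner_collective]
  congr 2
  ext i j
  fin_cases i <;> fin_cases j <;> simp

theorem inner_jplus (v w : Qubits ι) :
    inner ℂ (jplusHom ι v) w = inner ℂ v (jminusHom ι w) := by
  rw [← inner_conj_symm, ← inner_jminus, inner_conj_symm]

/-- A traceless one-qubit operator is a combination of the three angular momentum components. -/
theorem collectiveHom_of_trace_eq_zero {s : Matrix (Fin 2) (Fin 2) ℂ} (hs : s.trace = 0) :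
    collectiveHom ι s =
      (2 * s 0 0) • jzHom ι + s 0 1 • jplusHom ι + s 1 0 • jminusHom ι := by
  simp only [jzHom, jplusHom, jminusHom, ← map_smul, ← map_add]
  congr 1
  rw [Matrix.trace_fin_two] at hs
  ext i j
  fin_cases i <;> fin_cases j <;> simp
  · ring
  · linear_combination hs

/-- In the computational basis, `J_z` is diagonal: it counts the ones. -/
theorem jzHom_apply (v : Qubits ι) (x : ι → Fin 2) :
    jzHom ι v x = ((Fintype.card ι : ℂ) / 2 - ∑ i, ((x i : ℕ) : ℂ)) * v x := by
  rw [jzHom, collectiveHom_apply, collective_apply]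
  have h : ∀ i, ∑ c, (!![1 / 2, 0; 0, -1 / 2] : Matrix (Fin 2) (Fin 2) ℂ) (x i) c *
      v (Function.update x i c) = (1 / 2 - ((x i : ℕ) : ℂ)) * v x := by
    intro i
    rw [Finset.sum_eq_single (x i)]
    · rw [Function.update_eq_self]
      congr 1
      generalize x i = c
      fin_cases c <;> simp
      norm_num
    · intro c _ hc
      have : (!![1 / 2, 0; 0, -1 / 2] : Matrix (Fin 2) (Fin 2) ℂ) (x i) c = 0 := by
        generalize x i = d at hc
        fin_cases c <;> fin_cases d <;> simp at hc ⊢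
      rw [this, zero_mul]
    · simp
  rw [Finset.sum_congr rfl fun i _ => h i, ← Finset.sum_mul, Finset.sum_sub_distrib]
  simp [div_eq_mul_inv]

end CollectiveOperators

/-! ### Passage between the group `SU(2)` and the angular momentum operators -/

section Flow

variable {ι κ : Type} [Fintype ι] [DecidableEq ι] [Fintype κ] [DecidableEq κ]

/-- The operator `U^{⊗ ι}`. -/
def tensorPowLin (ι : Type) [Fintype ι] [DecidableEq ι] (U : Matrix (Fin 2) (Fin 2) ℂ) :
    Qubits ι →ₗ[ℂ] Qubits ι :=
  Matrix.toEuclideanLin (tensorPow ι U)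

theorem tensorPowLin_apply (U : Matrix (Fin 2) (Fin 2) ℂ) (v : Qubits ι) (x : ι → Fin 2) :
    tensorPowLin ι U v x = ∑ y, (∏ i, U (x i) (y i)) * v y := rfl

theorem tensorPowLin_one (v : Qubits ι) : tensorPowLin ι 1 v = v := by
  simp [tensorPowLin, tensorPow_one]

theorem hasDerivAt_qubits {f : ℝ → Qubits ι} {f' : Qubits ι} {t : ℝ}
    (h : ∀ x, HasDerivAt (fun t => f t x) (f' x) t) : HasDerivAt f f' t := by
  exact ((PiLp.continuousLinearEquiv 2 ℝ fun _ => ℂ).symm.toContinuousLinearMap.hasFDerivAt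
    (x := WithLp.ofLp (f t))).comp_hasDerivAt t (hasDerivAt_pi.2 h)

/-- The right-hand side has the shape of the product rule for `∏ i, U (x i) (y i)` with `U' = X U`,
so a derivative of the tensor power can be matched with it directly. -/
theorem collective_tensorPowLin (X U : Matrix (Fin 2) (Fin 2) ℂ) (v : Qubits ι)
    (x : ι → Fin 2) :
    collectiveHom ι X (tensorPowLin ι U v) x =
      ∑ y, (∑ i, (∏ j ∈ Finset.univ.erase i, U (x j) (y j)) * (X * U) (x i) (y i)) * v y := by
  rw [collectiveHom_apply, collective_apply]
  have h : ∀ (i : ι) (c : Fin 2) (y : ι → Fin 2), ∏ j, U (Function.update x i c j) (y j) =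
      U c (y i) * ∏ j ∈ Finset.univ.erase i, U (x j) (y j) := by
    intro i c y
    rw [← Finset.mul_prod_erase _ _ (Finset.mem_univ i), Function.update_self]
    congr 1
    refine Finset.prod_congr rfl fun j hj => ?_
    rw [Function.update_of_ne (Finset.ne_of_mem_erase hj)]
  simp only [tensorPowLin_apply, h, Matrix.mul_apply, Finset.sum_mul, Finset.mul_sum]
  rw [Finset.sum_comm' (t' := Finset.univ) (s' := fun _ => Finset.univ) (by simp)]
  simp only [Finset.sum_comm (s := (Finset.univ : Finset (ι → Fin 2)))]
  rw [Finset.sum_comm]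
  refine Finset.sum_congr rfl fun i _ => Finset.sum_congr rfl fun c _ =>
    Finset.sum_congr rfl fun y _ => ?_
  ring

/-- If `c' = X c` then `(c^{⊗ ι})' = J_X c^{⊗ ι}`. -/
theorem hasDerivAt_tensorPowLin {c : ℝ → Matrix (Fin 2) (Fin 2) ℂ} {X : Matrix (Fin 2) (Fin 2) ℂ}
    {t : ℝ} (h : ∀ i j, HasDerivAt (fun t => c t i j) ((X * c t) i j) t) (v : Qubits ι) :
    HasDerivAt (fun t => tensorPowLin ι (c t) v)
      (collectiveHom ι X (tensorPowLin ι (c t) v)) t := by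
  refine hasDerivAt_qubits fun x => ?_
  rw [collective_tensorPowLin]
  simp only [tensorPowLin_apply]
  refine HasDerivAt.fun_sum fun y _ => HasDerivAt.mul_const ?_ _
  exact HasDerivAt.fun_finsetProd fun i _ => h (x i) (y i)

/-- The one-parameter group `exp (t X)` for `X ^ 2 = -1`. -/
def qubitRotation (X : Matrix (Fin 2) (Fin 2) ℂ) (t : ℝ) : Matrix (Fin 2) (Fin 2) ℂ :=
  (Real.cos t : ℂ) • 1 + (Real.sin t : ℂ) • X

theorem qubitRotation_zero (X : Matrix (Fin 2) (Fin 2) ℂ) : qubitRotation X 0 = 1 := by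
  simp [qubitRotation]

theorem hasDerivAt_qubitRotation {X : Matrix (Fin 2) (Fin 2) ℂ} (hX : X * X = -1) (t : ℝ)
    (i j : Fin 2) :
    HasDerivAt (fun t => qubitRotation X t i j) ((X * qubitRotation X t) i j) t := by
  have h : X * qubitRotation X t = ((-Real.sin t : ℝ) : ℂ) • 1 + (Real.cos t : ℂ) • X := by
    simp [qubitRotation, mul_add, hX, add_comm]
  rw [h]
  simp only [qubitRotation, Matrix.add_apply, Matrix.smul_apply, smul_eq_mul]
  exact ((Real.hasDerivAt_cos t).ofReal_comp.mul_const _).add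
    ((Real.hasDerivAt_sin t).ofReal_comp.mul_const _)

theorem qubitRotation_mem {X : Matrix (Fin 2) (Fin 2) ℂ} (hX : X * X = -1) (hadj : Xᴴ = -X)
    (htr : X.trace = 0) (t : ℝ) :
    qubitRotation X t ∈ Matrix.specialUnitaryGroup (Fin 2) ℂ := by
  have hcs : ((Real.cos t : ℝ) : ℂ) * (Real.cos t : ℝ) + (Real.sin t : ℝ) * (Real.sin t : ℝ) = 1 := by
    rw [← Complex.ofReal_mul, ← Complex.ofReal_mul, ← Complex.ofReal_add, ← sq, ← sq,
      Real.cos_sq_add_sin_sq, Complex.ofReal_one]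
  rw [Matrix.mem_specialUnitaryGroup_iff, Matrix.mem_unitaryGroup_iff]
  constructor
  · rw [Matrix.star_eq_conjTranspose]
    simp only [qubitRotation, Matrix.conjTranspose_add, Matrix.conjTranspose_smul, hadj,
      Matrix.conjTranspose_one, add_mul, mul_add, smul_mul_assoc, mul_smul_comm, one_mul, mul_one,
      mul_neg, hX, Complex.star_def, Complex.conj_ofReal, smul_neg]
    trans (1 : ℂ) • (1 : Matrix (Fin 2) (Fin 2) ℂ)
    · rw [← hcs]
      module
    · rw [one_smul]
  · have h00 := congr_fun₂ hX 0 0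
    simp only [Matrix.mul_apply, Fin.sum_univ_two, Matrix.neg_apply, Matrix.one_apply_eq] at h00
    rw [Matrix.trace_fin_two] at htr
    rw [Matrix.det_fin_two]
    simp only [qubitRotation, Matrix.add_apply, Matrix.smul_apply, smul_eq_mul,
      Matrix.one_apply_eq, ne_eq, zero_ne_one, not_false_eq_true, Matrix.one_apply_ne,
      one_ne_zero]
    -- With zero trace, the `(0,0)` entry of `X² = -1` says `det X = 1`, so the determinant is `cos²
    -- + sin²`.
    linear_combination hcs + ((Real.cos t : ℂ) * Real.sin t + Real.sin t ^ 2 * X 0 0) * htr -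
      (Real.sin t : ℂ) ^ 2 * h00

/-- Every element of `SU(2)` lies on a one-parameter group. -/
theorem exists_qubitRotation (g : Matrix.specialUnitaryGroup (Fin 2) ℂ) :
    ∃ (X : Matrix (Fin 2) (Fin 2) ℂ) (t : ℝ), X * X = -1 ∧ X.trace = 0 ∧
      qubitRotation X t = (g : Matrix (Fin 2) (Fin 2) ℂ) := by
  obtain ⟨g, hg⟩ := g
  change ∃ (X : Matrix (Fin 2) (Fin 2) ℂ) (t : ℝ), X * X = -1 ∧ X.trace = 0 ∧
      qubitRotation X t = g
  rw [Matrix.mem_specialUnitaryGroup_iff] at hg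
  obtain ⟨hu, hdet⟩ := hg
  have hu1 := Matrix.mem_unitaryGroup_iff.1 hu
  have hu2 := Matrix.mem_unitaryGroup_iff'.1 hu
  have hadj : star g = g.adjugate := by
    calc star g = star g * (g * g.adjugate) := by rw [Matrix.mul_adjugate, hdet, one_smul, mul_one]
      _ = g.adjugate := by rw [← mul_assoc, hu2, one_mul]
  have h11 : g 1 1 = star (g 0 0) := by
    have := congr_fun₂ hadj 0 0
    rw [Matrix.adjugate_fin_two] at this
    simpa using this.symm
  have hnorm := congr_fun₂ hu1 0 0
  have hdet' := hdet
  rw [Matrix.det_fin_two] at hdet'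
  set a : ℝ := (g 0 0).re with ha
  have htr : g 0 0 + g 1 1 = 2 * (a : ℂ) := by
    rw [h11, Complex.star_def, Complex.add_conj]
    push_cast
    ring
  -- Cayley–Hamilton with determinant `1` and real trace `2a`. The rotation angle will be `arccos
  -- a`, and the traceless part `g - a` then squares to `-sin²`.
  have hsq : g * g = (2 * (a : ℂ)) • g - 1 := by
    ext i j
    fin_cases i <;> fin_cases j <;>
      simp [Matrix.mul_apply, Fin.sum_univ_two] <;> rw [← htr]
    · linear_combination -hdet'
    · ring
    · ring
    · linear_combination -hdet'
  have ha1 : a ^ 2 ≤ 1 := by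
    simp only [Matrix.mul_apply, Fin.sum_univ_two, Matrix.star_apply, Matrix.one_apply_eq] at hnorm
    have := congr_arg Complex.re hnorm
    simp only [Complex.star_def, Complex.add_re, Complex.mul_re, Complex.conj_re,
      Complex.conj_im, Complex.one_re, ← ha] at this
    nlinarith [sq_nonneg (g 0 0).im, sq_nonneg (g 0 1).im, sq_nonneg (g 0 1).re]
  have hab := abs_le.1 ((sq_le_one_iff_abs_le_one a).1 ha1)
  have hcos : Real.cos (Real.arccos a) = a := Real.cos_arccos hab.1 hab.2
  have hsc : ((Real.sin (Real.arccos a) : ℝ) : ℂ) ^ 2 = 1 - (a : ℂ) ^ 2 := by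
    rw [← Complex.ofReal_pow, Real.sin_sq, hcos]
    push_cast
    ring
  have hCH : (g - (a : ℂ) • 1) * (g - (a : ℂ) • 1) = ((a : ℂ) ^ 2 - 1) • 1 := by
    simp only [sub_mul, mul_sub, smul_mul_assoc, mul_smul_comm, one_mul, mul_one, hsq]
    module
  set s : ℂ := ((Real.sin (Real.arccos a) : ℝ) : ℂ) with hs
  by_cases hs0 : s = 0
  -- Here `g = ±1` and its traceless part gives no axis; any axis serves, and the `z` axis is taken.
  · have ha2 : a ^ 2 = 1 := by
      have : (a : ℂ) ^ 2 = 1 := by linear_combination hsc - s * hs0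
      exact_mod_cast this
    simp only [Matrix.mul_apply, Fin.sum_univ_two, Matrix.star_apply, Matrix.one_apply_eq] at hnorm
    have hre := congr_arg Complex.re hnorm
    simp only [Complex.star_def, Complex.add_re, Complex.mul_re, Complex.conj_re,
      Complex.conj_im, Complex.one_re, ← ha] at hre
    have him : (g 0 0).im = 0 := by
      nlinarith [sq_nonneg (g 0 0).im, sq_nonneg (g 0 1).im, sq_nonneg (g 0 1).re]
    have h01 : g 0 1 = 0 := by
      apply Complex.ext <;> simp only [Complex.zero_re, Complex.zero_im] <;>
        nlinarith [sq_nonneg (g 0 0).im, sq_nonneg (g 0 1).im, sq_nonneg (g 0 1).re]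
    have h00 : g 0 0 = a := by
      apply Complex.ext
      · rw [Complex.ofReal_re]
      · rw [Complex.ofReal_im, him]
    have h10 : g 1 0 = 0 := by
      have := congr_fun₂ hadj 0 1
      rw [Matrix.adjugate_fin_two] at this
      simpa [h01] using this
    refine ⟨!![Complex.I, 0; 0, -Complex.I], Real.arccos a, ?_, ?_, ?_⟩
    · ext i j
      fin_cases i <;> fin_cases j <;> simp
    · simp [Matrix.trace_fin_two]
    · rw [qubitRotation, hcos, ← hs, hs0]
      ext i j
      fin_cases i <;> fin_cases j <;> simp [h00, h01, h10, h11]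
  · refine ⟨s⁻¹ • (g - (a : ℂ) • 1), Real.arccos a, ?_, ?_, ?_⟩
    · rw [smul_mul_smul_comm, hCH, smul_smul]
      have : s⁻¹ * s⁻¹ * ((a : ℂ) ^ 2 - 1) = -1 := by
        field_simp
        linear_combination hsc
      rw [this, neg_smul, one_smul]
    · rw [Matrix.trace_smul, Matrix.trace_sub, Matrix.trace_smul, Matrix.trace_fin_two, htr]
      simp [mul_comm]
    · rw [qubitRotation, hcos, ← hs, smul_smul, mul_inv_cancel₀ hs0, one_smul]
      abel

/-- A linear map that intertwines the angular momentum operators on an invariant subspace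
intertwines the actions of `SU(2)` on it. -/
theorem intertwines_of_collective {W : Submodule ℂ (Qubits κ)} (T : Qubits κ →ₗ[ℂ] Qubits ι)
    (hW : ∀ U : Matrix (Fin 2) (Fin 2) ℂ, ∀ v ∈ W, tensorPowLin κ U v ∈ W)
    (hz : ∀ v ∈ W, T (jzHom κ v) = jzHom ι (T v))
    (hp : ∀ v ∈ W, T (jplusHom κ v) = jplusHom ι (T v))
    (hm : ∀ v ∈ W, T (jminusHom κ v) = jminusHom ι (T v))
    (g : Matrix.specialUnitaryGroup (Fin 2) ℂ) {v : Qubits κ} (hv : v ∈ W) :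
    T (qubitRep κ g v) = qubitRep ι g (T v) := by
  obtain ⟨X, t, hX, htr, hg⟩ := exists_qubitRotation g
  change T (tensorPowLin κ g v) = tensorPowLin ι g (T v)
  rw [← hg]
  have hT : ∀ w ∈ W, T (collectiveHom κ X w) = collectiveHom ι X (T w) := by
    intro w hw
    simp [collectiveHom_of_trace_eq_zero htr, hz w hw, hp w hw, hm w hw]
  let JX : Qubits ι →L[ℝ] Qubits ι :=
    (LinearMap.toContinuousLinearMap (collectiveHom ι X)).restrictScalars ℝ
  let TC : Qubits κ →L[ℝ] Qubits ι := (LinearMap.toContinuousLinearMap T).restrictScalars ℝ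
  -- Both curves solve `w' = J_X w` with value `T v` at time `0`. Stability of `W` keeps the orbit
  -- where `T` commutes with `J_X`.
  refine congr_fun (ODE_solution_unique_univ (v := fun _ w => JX w) (s := fun _ => Set.univ)
    (K := ‖JX‖₊) (t₀ := 0) (f := fun t => T (tensorPowLin κ (qubitRotation X t) v))
    (g := fun t => tensorPowLin ι (qubitRotation X t) (T v)) (fun _ => JX.lipschitz.lipschitzOnWith)
    (fun t => ⟨?_, trivial⟩) (fun t => ⟨?_, trivial⟩) ?_) t
  · have := TC.hasFDerivAt.comp_hasDerivAt t
      (hasDerivAt_tensorPowLin (hasDerivAt_qubitRotation hX t) v)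
    have h1 := hT _ (hW (qubitRotation X t) v hv)
    exact h1 ▸ this
  · exact hasDerivAt_tensorPowLin (hasDerivAt_qubitRotation hX t) (T v)
  · simp [qubitRotation_zero, tensorPowLin_one]

/-- A linear map that intertwines the actions of `SU(2)` on a subspace intertwines the
angular momentum operators on it. -/
theorem collective_of_intertwines {W : Submodule ℂ (Qubits κ)} (T : Qubits κ →ₗ[ℂ] Qubits ι)
    (hT : ∀ (g : Matrix.specialUnitaryGroup (Fin 2) ℂ), ∀ v ∈ W,
      T (qubitRep κ g v) = qubitRep ι g (T v)) {v : Qubits κ} (hv : v ∈ W) :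
    T (jzHom κ v) = jzHom ι (T v) ∧ T (jplusHom κ v) = jplusHom ι (T v) ∧
      T (jminusHom κ v) = jminusHom ι (T v) := by
  have key : ∀ X : Matrix (Fin 2) (Fin 2) ℂ, X * X = -1 →
      (∀ t, qubitRotation X t ∈ Matrix.specialUnitaryGroup (Fin 2) ℂ) →
      T (collectiveHom κ X v) = collectiveHom ι X (T v) := by
    intro X hX hmem
    let TC : Qubits κ →L[ℝ] Qubits ι := (LinearMap.toContinuousLinearMap T).restrictScalars ℝ
    have h1 := TC.hasFDerivAt.comp_hasDerivAt 0
      (hasDerivAt_tensorPowLin (hasDerivAt_qubitRotation hX 0) v)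
    have h2 := hasDerivAt_tensorPowLin (hasDerivAt_qubitRotation hX 0) (T v)
    have h3 : (fun t => tensorPowLin ι (qubitRotation X t) (T v)) =
        TC ∘ fun t => tensorPowLin κ (qubitRotation X t) v :=
      funext fun t => (hT ⟨_, hmem t⟩ v hv).symm
    rw [h3] at h2
    have := h1.unique h2
    rw [qubitRotation_zero, tensorPowLin_one, tensorPowLin_one] at this
    exact this
  have hmem : ∀ X : Matrix (Fin 2) (Fin 2) ℂ, X * X = -1 → Xᴴ = -X → X.trace = 0 →
      T (collectiveHom κ X v) = collectiveHom ι X (T v) :=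
    fun X h1 h2 h3 => key X h1 (qubitRotation_mem h1 h2 h3)
  -- The three generators are `i` times the Pauli matrices. Differentiation at `t = 0` gives the
  -- relation for `i(J_+ + J_-)`, `J_+ - J_-` and `2i J_z`, whose complex combinations recover the
  -- three operators.
  have hx := hmem !![0, Complex.I; Complex.I, 0]
    (by ext i j; fin_cases i <;> fin_cases j <;> simp)
    (by ext i j; fin_cases i <;> fin_cases j <;> simp) (by simp [Matrix.trace_fin_two])
  have hy := hmem !![0, 1; -1, 0]
    (by ext i j; fin_cases i <;> fin_cases j <;> simp)
    (by ext i j; fin_cases i <;> fin_cases j <;> simp) (by simp [Matrix.trace_fin_two])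
  have hz := hmem !![Complex.I, 0; 0, -Complex.I]
    (by ext i j; fin_cases i <;> fin_cases j <;> simp)
    (by ext i j; fin_cases i <;> fin_cases j <;> simp) (by simp [Matrix.trace_fin_two])
  rw [collectiveHom_of_trace_eq_zero (by simp [Matrix.trace_fin_two]),
    collectiveHom_of_trace_eq_zero (by simp [Matrix.trace_fin_two])] at hx hy hz
  simp only [Matrix.of_apply, Matrix.cons_val', Matrix.cons_val_zero, Matrix.cons_val_one,
    Matrix.cons_val_fin_one, mul_zero, zero_smul, zero_add, add_zero, one_smul, neg_smul,
    LinearMap.add_apply, LinearMap.smul_apply, LinearMap.neg_apply, map_add, map_smul,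
    map_neg] at hx hy hz
  have hx' := congr_arg (fun w => (-Complex.I) • w) hx
  simp only [smul_add, smul_smul, neg_mul, Complex.I_mul_I, neg_neg, one_smul] at hx'
  refine ⟨smul_right_injective _ (mul_ne_zero two_ne_zero Complex.I_ne_zero) hz, ?_, ?_⟩
  · have h2 := congr_arg₂ (· + ·) hx' hy
    refine smul_right_injective _ (two_ne_zero' ℂ) ?_
    simp only
    convert h2 using 1 <;> module
  · have h2 := congr_arg₂ (· - ·) hx' hy
    refine smul_right_injective _ (two_ne_zero' ℂ) ?_
    simp only
    convert h2 using 1 <;> module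

end Flow

/-! ### Highest weight vectors and the lowering operator -/

section HighestWeight

variable {ι : Type} [Fintype ι] [DecidableEq ι]

/-- The highest weight vectors of spin `j`. -/
def highestWeight (ι : Type) [Fintype ι] [DecidableEq ι] (j : ℕ) : Submodule ℂ (Qubits ι) where
  carrier := {v | jplusHom ι v = 0 ∧ jzHom ι v = (j : ℂ) • v}
  zero_mem' := by simp
  add_mem' := by
    rintro v w ⟨h1, h2⟩ ⟨h3, h4⟩
    exact ⟨by rw [map_add, h1, h3, add_zero], by rw [map_add, h2, h4, smul_add]⟩
  smul_mem' := by
    rintro c v ⟨h1, h2⟩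
    exact ⟨by rw [map_smul, h1, smul_zero], by rw [map_smul, h2, smul_comm]⟩

/-- The vector `J_- ^ p h`. -/
def lower (p : ℕ) (h : Qubits ι) : Qubits ι := (jminusHom ι ^ p) h

theorem lower_zero (h : Qubits ι) : lower 0 h = h := rfl

theorem lower_succ (p : ℕ) (h : Qubits ι) : lower (p + 1) h = jminusHom ι (lower p h) := by
  rw [lower, pow_succ', Module.End.mul_apply, lower]

theorem jz_lower {j : ℕ} {h : Qubits ι} (hh : h ∈ highestWeight ι j) (p : ℕ) :
    jzHom ι (lower p h) = ((j : ℂ) - p) • lower p h := by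
  induction p with
  | zero => simpa [lower_zero] using hh.2
  | succ p ih =>
    rw [lower_succ, jz_jminus, ih, map_smul, Nat.cast_succ]
    module

theorem jplus_lower {j : ℕ} {h : Qubits ι} (hh : h ∈ highestWeight ι j) (p : ℕ) :
    jplusHom ι (lower (p + 1) h) = (((p : ℂ) + 1) * (2 * j - p)) • lower p h := by
  induction p with
  | zero =>
    rw [lower_succ, lower_zero, jplus_jminus, hh.1, hh.2, map_zero, zero_add, smul_smul]
    simp
  | succ p ih =>
    rw [lower_succ (p + 1), jplus_jminus, ih, map_smul, ← lower_succ, jz_lower hh, smul_smul,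
      ← add_smul]
    congr 1
    push_cast
    ring

/-- The squared norm of `J_- ^ p h` for a unit vector `h` of highest weight `j`. -/
def lowerNormSq (j p : ℕ) : ℝ := ∏ q ∈ Finset.range p, ((q : ℝ) + 1) * (2 * j - q)

theorem lowerNormSq_succ (j p : ℕ) :
    lowerNormSq j (p + 1) = lowerNormSq j p * (((p : ℝ) + 1) * (2 * j - p)) :=
  Finset.prod_range_succ _ _

theorem lowerNormSq_pos {j p : ℕ} (hp : p ≤ 2 * j) : 0 < lowerNormSq j p := by
  refine Finset.prod_pos fun q hq => mul_pos (by positivity) ?_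
  have : (q : ℝ) < (2 * j : ℕ) := by exact_mod_cast (Finset.mem_range.1 hq).trans_le hp
  push_cast at this
  linarith

/-- Each `J_-` moved to the other side becomes a `J_+`, which undoes one lowering up to a scalar;
unequal powers end with `J_+` on a highest weight vector. The choice of `j'` in the factor is
harmless, since for `j ≠ j'` the vectors `h` and `h'` are orthogonal. -/
theorem inner_lower {j j' : ℕ} {h h' : Qubits ι} (hh : h ∈ highestWeight ι j)
    (hh' : h' ∈ highestWeight ι j') (p q : ℕ) :
    inner ℂ (lower p h) (lower q h') =
      if p = q then ((lowerNormSq j' p : ℝ) : ℂ) * inner ℂ h h' else 0 := by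
  induction p generalizing q with
  | zero =>
    cases q with
    | zero => simp [lower_zero, lowerNormSq]
    | succ q => simp [lower_zero, lower_succ, ← inner_jplus, hh.1]
  | succ p ih =>
    cases q with
    | zero => simp [lower_zero, lower_succ, inner_jminus, hh'.1]
    | succ q =>
      rw [lower_succ p, inner_jminus, jplus_lower hh', inner_smul_right, ih]
      simp only [Nat.add_right_cancel_iff, lowerNormSq_succ]
      split_ifs with hpq
      · subst hpq
        push_cast
        ring
      · simp

/-- The squared norm contains the factor `2j - q` with `q = 2j`. -/
theorem lower_eq_zero {j : ℕ} {h : Qubits ι} (hh : h ∈ highestWeight ι j) :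
    lower (2 * j + 1) h = 0 := by
  rw [← inner_self_eq_zero (𝕜 := ℂ), inner_lower hh hh, if_pos rfl, lowerNormSq_succ]
  simp

theorem inner_highestWeight_of_ne {j j' : ℕ} (hj : j ≠ j') {h h' : Qubits ι}
    (hh : h ∈ highestWeight ι j) (hh' : h' ∈ highestWeight ι j') : inner ℂ h h' = 0 := by
  have h1 := inner_jz h h'
  rw [hh.2, hh'.2, inner_smul_left, inner_smul_right, Complex.conj_natCast] at h1
  by_contra h2
  exact hj (Nat.cast_injective (mul_right_cancel₀ h2 h1))

end HighestWeight

/-! ### Symmetric tensors, Dicke states and multiplicities -/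

section Dicke

variable {ι κ : Type} [Fintype ι] [DecidableEq ι] [Fintype κ] [DecidableEq κ]

/-- The number of ones of a configuration. -/
def numOnes (x : κ → Fin 2) : ℕ := ∑ i, (x i : ℕ)

theorem numOnes_update_zero {x : κ → Fin 2} {i : κ} (h : x i = 1) :
    numOnes (Function.update x i 0) + 1 = numOnes x := by
  rw [numOnes, numOnes, ← Finset.add_sum_erase _ _ (Finset.mem_univ i),
    ← Finset.add_sum_erase (a := i) _ _ (Finset.mem_univ i), Function.update_self, h]
  have : ∑ j ∈ Finset.univ.erase i, ((Function.update x i 0 j : Fin 2) : ℕ) =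
      ∑ j ∈ Finset.univ.erase i, (x j : ℕ) :=
    Finset.sum_congr rfl fun j hj => by rw [Function.update_of_ne (Finset.ne_of_mem_erase hj)]
  rw [this]
  simp [add_comm]

theorem numOnes_update_one {x : κ → Fin 2} {i : κ} (h : x i = 0) :
    numOnes (Function.update x i 1) = numOnes x + 1 := by
  have := numOnes_update_zero (x := Function.update x i 1) (i := i) (by simp)
  rw [← this, Function.update_idem]
  nth_rewrite 1 [← h]
  rw [Function.update_eq_self]

theorem jplusHom_apply (v : Qubits κ) (x : κ → Fin 2) :
    jplusHom κ v x = ∑ i, if x i = 0 then v (Function.update x i 1) else 0 := by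
  rw [jplusHom, collectiveHom_apply, collective_apply]
  refine Finset.sum_congr rfl fun i _ => ?_
  generalize x i = c
  fin_cases c <;> simp

theorem jminusHom_apply (v : Qubits κ) (x : κ → Fin 2) :
    jminusHom κ v x = ∑ i, if x i = 1 then v (Function.update x i 0) else 0 := by
  rw [jminusHom, collectiveHom_apply, collective_apply]
  refine Finset.sum_congr rfl fun i _ => ?_
  generalize x i = c
  fin_cases c <;> simp

/-- The (unnormalized) Dicke state: the sum of the configurations with `μ` ones. -/
def dicke (κ : Type) [Fintype κ] (μ : ℕ) : Qubits κ :=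
  WithLp.toLp 2 fun x => if numOnes x = μ then 1 else 0

theorem dicke_apply (μ : ℕ) (x : κ → Fin 2) :
    dicke κ μ x = if numOnes x = μ then 1 else 0 := rfl

theorem sum_ite_eq_one (x : κ → Fin 2) (a : ℂ) :
    (∑ i, if x i = 1 then a else 0) = numOnes x * a := by
  rw [numOnes, Nat.cast_sum, Finset.sum_mul]
  refine Finset.sum_congr rfl fun i _ => ?_
  generalize x i = c
  fin_cases c <;> simp

theorem sum_ite_eq_zero (x : κ → Fin 2) (a : ℂ) :
    (∑ i, if x i = 0 then a else 0) = (Fintype.card κ - numOnes x) * a := by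
  rw [sub_mul, ← sum_ite_eq_one, ← nsmul_eq_mul, ← Finset.card_univ, ← Finset.sum_const,
    ← Finset.sum_sub_distrib]
  refine Finset.sum_congr rfl fun i _ => ?_
  generalize x i = c
  fin_cases c <;> simp

/-- A configuration with `μ + 1` ones is reached by flipping any one of them. Ones are spins down,
so here `μ` counts lowerings from the top, in contrast with the index of an angular momentum basis.
-/
theorem jminus_dicke (μ : ℕ) :
    jminusHom κ (dicke κ μ) = ((μ : ℂ) + 1) • dicke κ (μ + 1) := by
  ext x
  rw [jminusHom_apply, PiLp.smul_apply, dicke_apply, smul_eq_mul]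
  trans ∑ i, if x i = 1 then (if numOnes x = μ + 1 then (1 : ℂ) else 0) else 0
  · refine Finset.sum_congr rfl fun i _ => ?_
    split_ifs with h1 h2
    · have := numOnes_update_zero h1
      rw [dicke_apply, if_pos (by omega)]
    · have := numOnes_update_zero h1
      rw [dicke_apply, if_neg (by omega)]
    · rfl
  · rw [sum_ite_eq_one]
    split_ifs with h
    · rw [h]
      push_cast
      ring
    · simp

theorem jplus_dicke_succ (μ : ℕ) :
    jplusHom κ (dicke κ (μ + 1)) = ((Fintype.card κ : ℂ) - μ) • dicke κ μ := by
  ext x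
  rw [jplusHom_apply, PiLp.smul_apply, dicke_apply, smul_eq_mul]
  trans ∑ i, if x i = 0 then (if numOnes x = μ then (1 : ℂ) else 0) else 0
  · refine Finset.sum_congr rfl fun i _ => ?_
    split_ifs with h1 h2
    · rw [dicke_apply, numOnes_update_one h1, if_pos (by omega)]
    · rw [dicke_apply, numOnes_update_one h1, if_neg (by omega)]
    · rfl
  · rw [sum_ite_eq_zero]
    split_ifs with h
    · rw [h]
    · simp

theorem jplus_dicke_zero : jplusHom κ (dicke κ 0) = 0 := by
  ext x
  rw [jplusHom_apply]
  refine Finset.sum_eq_zero fun i _ => ?_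
  split_ifs with h
  · rw [dicke_apply, numOnes_update_one h, if_neg (by omega)]
  · rfl

theorem jz_dicke (μ : ℕ) :
    jzHom κ (dicke κ μ) = ((Fintype.card κ : ℂ) / 2 - μ) • dicke κ μ := by
  ext x
  rw [jzHom_apply, PiLp.smul_apply, dicke_apply, smul_eq_mul, ← Nat.cast_sum]
  split_ifs with h
  · rw [← h, numOnes]
  · simp

theorem numOnes_comp (s : Equiv.Perm κ) (x : κ → Fin 2) : numOnes (x ∘ s) = numOnes x :=
  Equiv.sum_comp s fun i => (x i : ℕ)

theorem dicke_mem (j μ : ℕ) : dicke (Fin (2 * j)) μ ∈ (symmetricQubits j).toSubmodule := by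
  intro s x
  rw [dicke_apply, dicke_apply, numOnes_comp]

theorem tensorPowLin_mem {j : ℕ} (U : Matrix (Fin 2) (Fin 2) ℂ) {v : Qubits (Fin (2 * j))}
    (hv : v ∈ (symmetricQubits j).toSubmodule) :
    tensorPowLin (Fin (2 * j)) U v ∈ (symmetricQubits j).toSubmodule := by
  intro s x
  rw [tensorPowLin_apply, tensorPowLin_apply]
  refine (Fintype.sum_equiv (s.arrowCongr (Equiv.refl (Fin 2))).symm _ _ fun y => ?_).symm
  have hy : (s.arrowCongr (Equiv.refl (Fin 2))).symm y = y ∘ s := by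
    ext i
    simp [Equiv.arrowCongr]
  rw [hy, hv s y]
  congr 1
  exact (Equiv.prod_comp s fun i => U (x i) (y i)).symm

theorem card_eq_numOnes (x : κ → Fin 2) : Fintype.card {i // x i = 1} = numOnes x := by
  rw [Fintype.card_subtype, Finset.card_filter, numOnes]
  refine Finset.sum_congr rfl fun i _ => ?_
  generalize x i = c
  fin_cases c <;> simp

theorem exists_perm_of_numOnes_eq {x y : κ → Fin 2} (h : numOnes x = numOnes y) :
    ∃ s : Equiv.Perm κ, x ∘ s = y := by
  have e : {i // y i = 1} ≃ {i // x i = 1} :=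
    Fintype.equivOfCardEq (by rw [card_eq_numOnes, card_eq_numOnes, h])
  refine ⟨e.extendSubtype, funext fun i => ?_⟩
  by_cases hi : y i = 1
  · rw [hi]
    exact e.extendSubtype_mem i hi
  · have := e.extendSubtype_not_mem i hi
    rw [Function.comp_apply]
    generalize e.extendSubtype i = a at *
    have h1 := Fin.exists_fin_two.1 ⟨x a, rfl⟩
    have h2 := Fin.exists_fin_two.1 ⟨y i, rfl⟩
    grind

/-- The configuration `1…10…0` with `μ` ones. -/
def stdConfig (j μ : ℕ) : Fin (2 * j) → Fin 2 := fun i => if (i : ℕ) < μ then 1 else 0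

theorem numOnes_stdConfig {j μ : ℕ} (h : μ ≤ 2 * j) : numOnes (stdConfig j μ) = μ := by
  rw [← card_eq_numOnes, Fintype.card_subtype]
  have : ∀ i : Fin (2 * j), stdConfig j μ i = 1 ↔ (i : ℕ) < μ := by
    intro i
    simp [stdConfig]
  simp only [this]
  rw [Fin.card_filter_val_lt]
  omega

theorem numOnes_le (x : κ → Fin 2) : numOnes x ≤ Fintype.card κ := by
  rw [← card_eq_numOnes]
  exact Fintype.card_subtype_le _

/-- Permutations act transitively on the configurations with a given number of ones, so the
amplitudes of a symmetric tensor depend on that number only. -/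
theorem symmetric_eq_sum_dicke {j : ℕ} {v : Qubits (Fin (2 * j))}
    (hv : v ∈ (symmetricQubits j).toSubmodule) :
    v = ∑ μ ∈ Finset.range (2 * j + 1), v (stdConfig j μ) • dicke (Fin (2 * j)) μ := by
  ext x
  have hx : numOnes x ≤ 2 * j := by simpa using numOnes_le x
  simp only [WithLp.ofLp_sum, Finset.sum_apply, PiLp.smul_apply, dicke_apply, smul_eq_mul,
    mul_ite, mul_one, mul_zero]
  rw [Finset.sum_ite_eq, if_pos (Finset.mem_range.2 (by omega))]
  obtain ⟨s, hs⟩ := exists_perm_of_numOnes_eq (numOnes_stdConfig hx)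
  rw [← hv s (stdConfig j (numOnes x)), hs]

/-- The linear map that sends the Dicke states to the vectors `t μ`. -/
def dickeLift (j : ℕ) (t : ℕ → Qubits ι) : Qubits (Fin (2 * j)) →ₗ[ℂ] Qubits ι where
  toFun v := ∑ μ ∈ Finset.range (2 * j + 1), v (stdConfig j μ) • t μ
  map_add' v w := by simp [add_smul, Finset.sum_add_distrib]
  map_smul' c v := by simp [mul_smul, Finset.smul_sum]

theorem dickeLift_apply (j : ℕ) (t : ℕ → Qubits ι) (v : Qubits (Fin (2 * j))) :
    dickeLift j t v = ∑ μ ∈ Finset.range (2 * j + 1), v (stdConfig j μ) • t μ := rfl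

theorem dickeLift_dicke {j μ : ℕ} (t : ℕ → Qubits ι) (hμ : μ ≤ 2 * j) :
    dickeLift j t (dicke _ μ) = t μ := by
  rw [dickeLift_apply, Finset.sum_eq_single μ]
  · rw [dicke_apply, numOnes_stdConfig hμ, if_pos rfl, one_smul]
  · intro ν hν hne
    rw [dicke_apply, numOnes_stdConfig (Nat.lt_succ_iff.1 (Finset.mem_range.1 hν)), if_neg hne,
      zero_smul]
  · intro h
    exact absurd (Finset.mem_range.2 (Nat.lt_succ_of_le hμ)) h

theorem dicke_eq_zero {j μ : ℕ} (hμ : 2 * j < μ) : dicke (Fin (2 * j)) μ = 0 := by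
  ext x
  have hx : numOnes x ≤ 2 * j := by simpa using numOnes_le x
  rw [dicke_apply, if_neg (by omega)]
  rfl

theorem map_eq_of_dicke {j : ℕ} {F G : Qubits (Fin (2 * j)) →ₗ[ℂ] Qubits ι}
    (h : ∀ μ ≤ 2 * j, F (dicke _ μ) = G (dicke _ μ)) {v : Qubits (Fin (2 * j))}
    (hv : v ∈ (symmetricQubits j).toSubmodule) : F v = G v := by
  rw [symmetric_eq_sum_dicke hv, map_sum, map_sum]
  refine Finset.sum_congr rfl fun μ hμ => ?_
  rw [map_smul, map_smul, h μ (Nat.lt_succ_iff.1 (Finset.mem_range.1 hμ))]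

/-- The collective operators live on all the qubits while `f` is defined on symmetric tensors only;
an arbitrary linear extension suffices, because commutation is needed on that subspace alone. -/
theorem extension_dicke {j : ℕ} (f : Representation.IntertwiningMap (spinRep j) (qubitRep ι)) :
    ∃ T : Qubits (Fin (2 * j)) →ₗ[ℂ] Qubits ι,
      (∀ v : (symmetricQubits j).toSubmodule, T v = f v) ∧
      (∀ v ∈ (symmetricQubits j).toSubmodule, T (jzHom _ v) = jzHom ι (T v) ∧
        T (jplusHom _ v) = jplusHom ι (T v) ∧ T (jminusHom _ v) = jminusHom ι (T v)) := by
  obtain ⟨T, hT⟩ := LinearMap.exists_extend f.toLinearMap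
  have hT' : ∀ v : (symmetricQubits j).toSubmodule, T v = f v := fun v =>
    LinearMap.congr_fun hT v
  refine ⟨T, hT', fun v hv => collective_of_intertwines T (fun g v hv => ?_) hv⟩
  have h1 := Representation.IntertwiningMap.isIntertwining _ _ f g ⟨v, hv⟩
  rw [← hT', ← hT'] at h1
  exact h1

/-- The value of an intertwining map at the highest weight vector of `V^j`. -/
def highestWeightEval (ι : Type) [Fintype ι] [DecidableEq ι] (j : ℕ) :
    Representation.IntertwiningMap (spinRep j) (qubitRep ι) →ₗ[ℂ] highestWeight ι j where
  toFun f := ⟨f ⟨dicke _ 0, dicke_mem j 0⟩, by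
    obtain ⟨T, hT, hJ⟩ := extension_dicke f
    obtain ⟨h1, h2, -⟩ := hJ _ (dicke_mem j 0)
    rw [← hT]
    refine ⟨?_, ?_⟩
    · rw [← h2, jplus_dicke_zero, map_zero]
    · rw [← h1, jz_dicke, map_smul]
      simp⟩
  map_add' _ _ := rfl
  map_smul' _ _ := rfl

/-- An intertwiner commutes with `J_-`, and `J_-` generates all the Dicke states from the top one.
-/
theorem highestWeightEval_injective (j : ℕ) : Function.Injective (highestWeightEval ι j) := by
  rw [injective_iff_map_eq_zero]
  intro f hf
  obtain ⟨T, hT, hJ⟩ := extension_dicke f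
  have h0 : T (dicke _ 0) = 0 := by
    have := congr_arg Subtype.val hf
    exact (hT ⟨_, dicke_mem j 0⟩).trans this
  have hd : ∀ μ, T (dicke _ μ) = 0 := by
    intro μ
    induction μ with
    | zero => exact h0
    | succ μ ih =>
      have := (hJ _ (dicke_mem j μ)).2.2
      rw [ih, map_zero, jminus_dicke, map_smul] at this
      exact (smul_eq_zero.1 this).resolve_left (Nat.cast_add_one_ne_zero μ)
  ext v : 2
  rw [Representation.IntertwiningMap.toLinearMap_apply, ← hT]
  exact map_eq_of_dicke (G := 0) (fun μ _ => hd μ) v.2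

/-- The lowered vectors of `h`, suitably scaled, transform under `J_z` and `J_±` exactly as the
Dicke states do; the resulting map therefore commutes with the group. -/
theorem highestWeightEval_surjective (j : ℕ) : Function.Surjective (highestWeightEval ι j) := by
  rintro ⟨h, hh⟩
  -- The factor matches `J_-^μ` applied to the top Dicke state, which is `μ!` times the Dicke state
  -- with `μ` ones.
  let t : ℕ → Qubits ι := fun μ => ((μ.factorial : ℂ))⁻¹ • lower μ h
  have hfac : ∀ μ : ℕ, ((μ + 1 : ℕ).factorial : ℂ) = ((μ : ℂ) + 1) * μ.factorial := fun μ => by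
    push_cast [Nat.factorial_succ]
    ring
  have hne : ∀ μ : ℕ, (μ : ℂ) + 1 ≠ 0 := Nat.cast_add_one_ne_zero
  have hfne : ∀ μ : ℕ, (μ.factorial : ℂ) ≠ 0 := fun μ => Nat.cast_ne_zero.2 μ.factorial_ne_zero
  have tm : ∀ μ, jminusHom ι (t μ) = ((μ : ℂ) + 1) • t (μ + 1) := by
    intro μ
    simp only [t]
    rw [map_smul, ← lower_succ, smul_smul, hfac]
    congr 1
    field_simp [hne μ, hfne μ]
  have tp : ∀ μ, jplusHom ι (t (μ + 1)) = (2 * (j : ℂ) - μ) • t μ := by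
    intro μ
    simp only [t]
    rw [map_smul, jplus_lower hh, smul_smul, smul_smul, hfac]
    congr 1
    field_simp [hne μ, hfne μ]
  have tz : ∀ μ, jzHom ι (t μ) = ((j : ℂ) - μ) • t μ := by
    intro μ
    simp only [t]
    rw [map_smul, jz_lower hh, smul_comm]
  have t0 : t 0 = h := by simp [t, lower_zero]
  have tlast : t (2 * j + 1) = 0 := by simp [t, lower_eq_zero hh]
  have hT := fun μ hμ => dickeLift_dicke (j := j) (μ := μ) t hμ
  have hcard : ((Fintype.card (Fin (2 * j)) : ℕ) : ℂ) = 2 * j := by simp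
  have hint : ∀ (g : Matrix.specialUnitaryGroup (Fin 2) ℂ) {v : Qubits (Fin (2 * j))},
      v ∈ (symmetricQubits j).toSubmodule →
      dickeLift j t (qubitRep _ g v) = qubitRep ι g (dickeLift j t v) := by
    refine intertwines_of_collective (W := (symmetricQubits j).toSubmodule) (dickeLift j t)
      (fun U v hv => tensorPowLin_mem U hv) (fun v hv => ?_) (fun v hv => ?_) (fun v hv => ?_)
    · refine map_eq_of_dicke (F := dickeLift j t ∘ₗ jzHom _) (G := jzHom ι ∘ₗ dickeLift j t)
        (fun μ hμ => ?_) hv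
      simp only [LinearMap.comp_apply, jz_dicke, map_smul, hT μ hμ, tz, hcard]
      congr 1
      ring
    · refine map_eq_of_dicke (F := dickeLift j t ∘ₗ jplusHom _)
        (G := jplusHom ι ∘ₗ dickeLift j t) (fun μ hμ => ?_) hv
      simp only [LinearMap.comp_apply, hT μ hμ]
      cases μ with
      | zero => rw [jplus_dicke_zero, t0, hh.1, map_zero]
      | succ μ => rw [jplus_dicke_succ, map_smul, hT μ (by omega), tp, hcard]
    · refine map_eq_of_dicke (F := dickeLift j t ∘ₗ jminusHom _)
        (G := jminusHom ι ∘ₗ dickeLift j t) (fun μ hμ => ?_) hv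
      simp only [LinearMap.comp_apply, hT μ hμ, jminus_dicke, map_smul, tm]
      rcases hμ.lt_or_eq with hlt | rfl
      · rw [hT (μ + 1) hlt]
      -- At the bottom, `μ = 2j`, both sides vanish: no configuration has `2j + 1` ones, and `h` can
      -- be lowered only `2j` times.
      · rw [dicke_eq_zero (Nat.lt_succ_self _), tlast, map_zero]
  refine ⟨⟨(dickeLift j t).domRestrict _, fun g => ?_⟩, Subtype.ext ?_⟩
  · ext v : 1
    exact hint g v.2
  · exact (hT 0 (Nat.zero_le _)).trans t0

/-- The multiplicity of spin `j` is the dimension of the space of its highest weight vectors. -/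
theorem finrank_highestWeight (j : ℕ) :
    Module.finrank ℂ (highestWeight ι j) = spinMult ι j :=
  (LinearEquiv.ofBijective (highestWeightEval ι j)
    ⟨highestWeightEval_injective j, highestWeightEval_surjective j⟩).finrank_eq.symm

end Dicke

/-! ### Invariant vectors as the kernel of the angular momentum -/

section Singlets

variable {ι : Type} [Fintype ι] [DecidableEq ι]

/-- The invariant vectors are those annihilated by the angular momentum. -/
theorem mem_singletSpace_iff {v : Qubits ι} :
    v ∈ singletSpace ι ↔ jzHom ι v = 0 ∧ jplusHom ι v = 0 ∧ jminusHom ι v = 0 := by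
  -- Zero qubits carry the trivial representation, so `v` is invariant exactly when this map from it
  -- is an intertwiner; both directions then follow from the correspondence between group and ladder
  -- operators.
  let T : Qubits (Fin 0) →ₗ[ℂ] Qubits ι :=
    { toFun := fun w => w finZeroElim • v
      map_add' := fun w w' => add_smul _ _ _
      map_smul' := fun c w => mul_smul _ _ _ }
  let o : Qubits (Fin 0) := WithLp.toLp 2 fun _ => 1
  have hTo : T o = v := one_smul _ _
  have hzero : ∀ s (w : Qubits (Fin 0)), collectiveHom (Fin 0) s w = 0 := by
    intro s w
    simp [collectiveHom_eq_sum]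
  have hone : ∀ U (w : Qubits (Fin 0)), tensorPowLin (Fin 0) U w = w := by
    intro U w
    ext x
    rw [tensorPowLin_apply, Fintype.sum_unique]
    rw [Subsingleton.elim x default]
    rw [Finset.univ_eq_empty, Finset.prod_empty, one_mul]
    exact congr_arg w (Subsingleton.elim _ _)
  constructor
  · intro hv
    have := collective_of_intertwines (W := ⊤) T (fun g w _ => ?_) (v := o) trivial
    · rw [hTo] at this
      simp only [jzHom, jplusHom, jminusHom, hzero, map_zero] at this ⊢
      exact ⟨this.1.symm, this.2.1.symm, this.2.2.symm⟩
    · change T (tensorPowLin _ g w) = qubitRep ι g (w finZeroElim • v)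
      rw [hone, map_smul, hv g]
      rfl
  · rintro ⟨h1, h2, h3⟩ g
    have := intertwines_of_collective (W := ⊤) T (fun _ _ _ => trivial)
      (fun w _ => ?_) (fun w _ => ?_) (fun w _ => ?_) g (v := o) trivial
    · rw [hTo] at this
      change T (tensorPowLin _ g o) = _ at this
      rw [hone, hTo] at this
      exact this.symm
    · rw [jzHom, hzero, map_zero]
      exact (by rw [map_smul, h1, smul_zero] : jzHom ι (w finZeroElim • v) = 0).symm
    · rw [jplusHom, hzero, map_zero]
      exact (by rw [map_smul, h2, smul_zero] : jplusHom ι (w finZeroElim • v) = 0).symm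
    · rw [jminusHom, hzero, map_zero]
      exact (by rw [map_smul, h3, smul_zero] : jminusHom ι (w finZeroElim • v) = 0).symm

end Singlets

/-! ### Existence of angular momentum bases -/

section AngularMomentumBasis

variable {ι : Type} [Fintype ι] [DecidableEq ι]

theorem jz_eigenvalue {v : Qubits ι} (hv : v ≠ 0) {c : ℂ} (h : jzHom ι v = c • v) :
    ∃ x : ι → Fin 2, c = (Fintype.card ι : ℂ) / 2 - numOnes x := by
  obtain ⟨x, hx⟩ : ∃ x, v x ≠ 0 := by
    by_contra! h0
    exact hv (by ext x; exact h0 x)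
  refine ⟨x, ?_⟩
  have h1 : jzHom ι v x = c * v x := by rw [h]; rfl
  rw [jzHom_apply, ← Nat.cast_sum] at h1
  exact (mul_right_cancel₀ hx h1).symm

theorem exists_jz_eigenvector {W : Submodule ℂ (Qubits ι)} (hW : W ≠ ⊥)
    (hz : ∀ v ∈ W, jzHom ι v ∈ W) :
    ∃ v ∈ W, v ≠ 0 ∧ ∃ w : ℕ, jzHom ι v = ((Fintype.card ι : ℂ) / 2 - w) • v := by
  have : Nontrivial W := Submodule.nontrivial_iff_ne_bot.2 hW
  obtain ⟨c, hc⟩ := Module.End.exists_eigenvalue ((jzHom ι).restrict hz)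
  obtain ⟨v, hv⟩ := hc.exists_hasEigenvector
  have h1 : jzHom ι v = c • (v : Qubits ι) := congr_arg Subtype.val hv.apply_eq_smul
  have h2 : (v : Qubits ι) ≠ 0 := fun h => hv.2 (Subtype.ext h)
  obtain ⟨x, hx⟩ := jz_eigenvalue h2 h1
  exact ⟨v, v.2, h2, numOnes x, hx ▸ h1⟩

/-- If `J_+ v = 0` and `v` has weight `m`, then `‖J_- v‖² = 2m ‖v‖²`, so `m ≥ 0`. Hence the natural
subtraction `K - w` is not truncated. -/
theorem mem_highestWeight_of_jplus_eq_zero {K w : ℕ} {v : Qubits ι} (hK : Fintype.card ι = 2 * K)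
    (hv : v ≠ 0) (hp : jplusHom ι v = 0)
    (hz : jzHom ι v = ((Fintype.card ι : ℂ) / 2 - w) • v) : v ∈ highestWeight ι (K - w) := by
  have hc : (Fintype.card ι : ℂ) / 2 - w = (((K : ℝ) - w : ℝ) : ℂ) := by
    rw [hK]
    push_cast
    ring
  rw [hc] at hz
  have h1 : inner ℂ (jminusHom ι v) (jminusHom ι v) = ((2 * ((K : ℝ) - w) * ‖v‖ ^ 2 : ℝ) : ℂ) := by
    rw [inner_jminus, jplus_jminus, hp, hz, map_zero, zero_add, inner_smul_right, inner_smul_right,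
      inner_self_eq_norm_sq_to_K]
    push_cast
    simp
    ring
  rw [inner_self_eq_norm_sq_to_K] at h1
  have h2 : ‖jminusHom ι v‖ ^ 2 = 2 * ((K : ℝ) - w) * ‖v‖ ^ 2 := by
    apply Complex.ofReal_injective
    rw [← h1, Complex.ofReal_pow]
    rfl
  have h3 : 0 < ‖v‖ ^ 2 := by positivity
  have h4 : (0 : ℝ) ≤ (K : ℝ) - w := by
    by_contra! h5
    nlinarith [sq_nonneg ‖jminusHom ι v‖]
  have h5 : w ≤ K := by exact_mod_cast sub_nonneg.1 h4
  refine ⟨hp, ?_⟩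
  rw [hz, Nat.cast_sub h5]
  push_cast
  rfl

/-- A nonzero subspace stable under `J_z` and `J_+` contains a highest weight vector. -/
theorem exists_highestWeight {K : ℕ} (hK : Fintype.card ι = 2 * K)
    {W : Submodule ℂ (Qubits ι)} (hW : W ≠ ⊥)
    (hz : ∀ v ∈ W, jzHom ι v ∈ W) (hp : ∀ v ∈ W, jplusHom ι v ∈ W) :
    ∃ j, ∃ v ∈ W, v ≠ 0 ∧ v ∈ highestWeight ι j := by
  classical
  have hex : ∃ w : ℕ, ∃ v ∈ W, v ≠ 0 ∧ jzHom ι v = ((Fintype.card ι : ℂ) / 2 - w) • v := by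
    obtain ⟨v, hvW, hv0, w, hw⟩ := exists_jz_eigenvector hW hz
    exact ⟨w, v, hvW, hv0, hw⟩
  -- The least `w` is the greatest weight in `W`; a nonzero `J_+ v` would have a smaller `w`.
  obtain ⟨v, hvW, hv0, hv⟩ := Nat.find_spec hex
  refine ⟨K - Nat.find hex, v, hvW, hv0, mem_highestWeight_of_jplus_eq_zero hK hv0 ?_ hv⟩
  by_contra hne
  have h1 : jzHom ι (jplusHom ι v) =
      ((Fintype.card ι : ℂ) / 2 - (Nat.find hex : ℂ) + 1) • jplusHom ι v := by
    rw [jz_jplus, hv, map_smul]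
    module
  obtain ⟨x, hx⟩ := jz_eigenvalue hne h1
  have h2 : numOnes x < Nat.find hex := by
    have : ((numOnes x + 1 : ℕ) : ℂ) = (Nat.find hex : ℕ) := by
      push_cast
      linear_combination hx
    have := Nat.cast_injective this
    omega
  exact Nat.find_min hex h2 ⟨jplusHom ι v, hp v hvW, hne, hx ▸ h1⟩

/-- The vector `|j, m⟩`, `m = μ - j`, of the multiplet with highest weight vector `h`. -/
def multiplet (j : ℕ) (h : Qubits ι) (μ : ℕ) : Qubits ι :=
  ((Real.sqrt (lowerNormSq j (2 * j - μ)) : ℝ) : ℂ)⁻¹ • lower (2 * j - μ) h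

theorem inner_multiplet {j j' : ℕ} {h h' : Qubits ι} (hh : h ∈ highestWeight ι j)
    (hh' : h' ∈ highestWeight ι j') (μ ν : ℕ) (hne : (2 * j - μ ≠ 2 * j' - ν) ∨ inner ℂ h h' = 0) :
    inner ℂ (multiplet j h μ) (multiplet j' h' ν) = 0 := by
  rw [multiplet, multiplet, inner_smul_left, inner_smul_right, inner_lower hh hh']
  rcases hne with h1 | h1
  · simp [h1]
  · simp [h1]

theorem norm_multiplet {j : ℕ} {h : Qubits ι} (hh : h ∈ highestWeight ι j) (h1 : ‖h‖ = 1) (μ : ℕ) :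
    ‖multiplet j h μ‖ = 1 := by
  have hpos := lowerNormSq_pos (j := j) (p := 2 * j - μ) (Nat.sub_le _ _)
  have h2 : ‖lower (2 * j - μ) h‖ ^ 2 = lowerNormSq j (2 * j - μ) := by
    have := inner_lower hh hh (2 * j - μ) (2 * j - μ)
    rw [if_pos rfl, inner_self_eq_norm_sq_to_K, inner_self_eq_norm_sq_to_K, h1] at this
    simp only [Complex.coe_algebraMap, Complex.ofReal_one, one_pow, mul_one] at this
    exact_mod_cast this
  have h3 : ‖lower (2 * j - μ) h‖ = Real.sqrt (lowerNormSq j (2 * j - μ)) := by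
    rw [← h2, Real.sqrt_sq (norm_nonneg _)]
  rw [multiplet, norm_smul, norm_inv, Complex.norm_real, Real.norm_eq_abs,
    abs_of_nonneg (Real.sqrt_nonneg _), h3]
  exact inv_mul_cancel₀ (Real.sqrt_ne_zero'.2 hpos)

theorem jz_multiplet {j : ℕ} {h : Qubits ι} (hh : h ∈ highestWeight ι j) {μ : ℕ} (hμ : μ ≤ 2 * j) :
    jzHom ι (multiplet j h μ) = ((μ : ℂ) - j) • multiplet j h μ := by
  rw [multiplet, map_smul, jz_lower hh, Nat.cast_sub hμ, smul_comm]
  congr 1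
  push_cast
  ring

theorem jplus_multiplet_last {j : ℕ} {h : Qubits ι} (hh : h ∈ highestWeight ι j) :
    jplusHom ι (multiplet j h (2 * j)) = 0 := by
  rw [multiplet, map_smul, Nat.sub_self, lower_zero, hh.1, smul_zero]

theorem jminus_multiplet_zero {j : ℕ} {h : Qubits ι} (hh : h ∈ highestWeight ι j) :
    jminusHom ι (multiplet j h 0) = 0 := by
  rw [multiplet, map_smul, Nat.sub_zero, ← lower_succ, lower_eq_zero hh, smul_zero]

theorem jplus_multiplet {j : ℕ} {h : Qubits ι} (hh : h ∈ highestWeight ι j) {μ : ℕ}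
    (hμ : μ < 2 * j) :
    jplusHom ι (multiplet j h μ) =
      ((Real.sqrt ((2 * (j : ℝ) - μ) * ((μ : ℝ) + 1)) : ℝ) : ℂ) • multiplet j h (μ + 1) := by
  -- Here `p` is the number of lowerings that lead to index `μ + 1`; the quantity under the square
  -- root becomes `(p + 1)(μ + 1)`.
  obtain ⟨p, hp⟩ : ∃ p, 2 * j = p + 1 + μ := ⟨2 * j - μ - 1, by omega⟩
  have hpR : (2 * (j : ℝ)) = p + 1 + μ := by exact_mod_cast hp
  have e1 : 2 * j - μ = p + 1 := by omega
  have e2 : 2 * j - (μ + 1) = p := by omega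
  have hc : (((p : ℂ) + 1) * (2 * j - p)) = (((p + 1) * (μ + 1) : ℝ) : ℂ) := by
    have : (2 * (j : ℂ)) = p + 1 + μ := by exact_mod_cast hp
    rw [this]
    push_cast
    ring
  have hpos : 0 < lowerNormSq j p := lowerNormSq_pos (by omega)
  rw [multiplet, multiplet, e1, e2, map_smul, jplus_lower hh, smul_smul, smul_smul, hc,
    lowerNormSq_succ, hpR]
  congr 1
  rw [← Complex.ofReal_inv, ← Complex.ofReal_inv, ← Complex.ofReal_mul, ← Complex.ofReal_mul]
  congr 1
  have e3 : ((p : ℝ) + 1) * ((p : ℝ) + 1 + μ - p) = (p + 1) * (μ + 1) := by ring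
  have e4 : ((p : ℝ) + 1 + μ - μ) * (μ + 1) = (p + 1) * (μ + 1) := by ring
  rw [e3, e4, Real.sqrt_mul hpos.le]
  have h1 : Real.sqrt (lowerNormSq j p) ≠ 0 := Real.sqrt_ne_zero'.2 hpos
  have hq : (0 : ℝ) < (p + 1) * (μ + 1) := by positivity
  have h2 : Real.sqrt (((p : ℝ) + 1) * (μ + 1)) ≠ 0 := Real.sqrt_ne_zero'.2 hq
  nth_rewrite 2 [← Real.mul_self_sqrt hq.le]
  field_simp

theorem jminus_multiplet {j : ℕ} {h : Qubits ι} {μ : ℕ}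
    (hμ : μ < 2 * j) :
    jminusHom ι (multiplet j h (μ + 1)) =
      ((Real.sqrt ((2 * (j : ℝ) - μ) * ((μ : ℝ) + 1)) : ℝ) : ℂ) • multiplet j h μ := by
  obtain ⟨p, hp⟩ : ∃ p, 2 * j = p + 1 + μ := ⟨2 * j - μ - 1, by omega⟩
  have hpR : (2 * (j : ℝ)) = p + 1 + μ := by exact_mod_cast hp
  have e1 : 2 * j - μ = p + 1 := by omega
  have e2 : 2 * j - (μ + 1) = p := by omega
  have hpos : 0 < lowerNormSq j p := lowerNormSq_pos (by omega)
  rw [multiplet, multiplet, e1, e2, map_smul, ← lower_succ, smul_smul, lowerNormSq_succ, hpR]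
  congr 1
  rw [← Complex.ofReal_inv, ← Complex.ofReal_inv, ← Complex.ofReal_mul]
  congr 1
  have e3 : ((p : ℝ) + 1) * ((p : ℝ) + 1 + μ - p) = (p + 1) * (μ + 1) := by ring
  have e4 : ((p : ℝ) + 1 + μ - μ) * (μ + 1) = (p + 1) * (μ + 1) := by ring
  rw [e3, e4, Real.sqrt_mul hpos.le]
  have h1 : Real.sqrt (lowerNormSq j p) ≠ 0 := Real.sqrt_ne_zero'.2 hpos
  have hq : (0 : ℝ) < (p + 1) * (μ + 1) := by positivity
  have h2 : Real.sqrt (((p : ℝ) + 1) * (μ + 1)) ≠ 0 := Real.sqrt_ne_zero'.2 hq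
  field_simp

/-- Angular momentum bases of an even number of qubits exist. -/
theorem exists_isAngularMomentumBasis {K : ℕ} (hK : Fintype.card ι = 2 * K) :
    ∃ e : (j : ℕ) → Fin (spinMult ι j) → Fin (2 * j + 1) → Qubits ι,
      IsAngularMomentumBasis e := by
  let h : ∀ j, OrthonormalBasis (Fin (spinMult ι j)) ℂ (highestWeight ι j) := fun j =>
    (stdOrthonormalBasis ℂ (highestWeight ι j)).reindex (finCongr (finrank_highestWeight j))
  have hmem : ∀ j a, (h j a : Qubits ι) ∈ highestWeight ι j := fun j a => (h j a).2
  have hjm : ∀ j a (μ : Fin (2 * j)), jminusHom ι (multiplet j (h j a : Qubits ι) (μ.succ : ℕ)) =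
      ((Real.sqrt ((2 * (j : ℝ) - (μ : ℝ)) * ((μ : ℝ) + 1)) : ℝ) : ℂ) •
        multiplet j (h j a : Qubits ι) (μ.castSucc : ℕ) := by
    intro j a μ
    rw [Fin.val_succ, jminus_multiplet μ.2, Fin.val_castSucc]
  refine ⟨fun j a μ => multiplet j (h j a) μ, ⟨⟨?_, ?_⟩, ?_, ?_, ?_, ?_, ?_, ?_⟩⟩
  · rintro ⟨j, a, μ⟩
    exact norm_multiplet (hmem j a) ((h j).norm_eq_one a) μ
  · rintro ⟨j, a, μ⟩ ⟨j', a', ν⟩ hne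
    refine inner_multiplet (hmem j a) (hmem j' a') _ _ ?_
    by_cases hj : j = j'
    · subst hj
      by_cases ha : a = a'
      · subst ha
        left
        have : (μ : ℕ) ≠ ν := fun h => hne (by rw [Fin.ext h])
        have := μ.2
        have := ν.2
        change 2 * j - (μ : ℕ) ≠ 2 * j - (ν : ℕ)
        omega
      · right
        exact (h j).inner_eq_zero ha
    · right
      exact inner_highestWeight_of_ne hj (hmem j a) (hmem j' a')
  · set W := Submodule.span ℂ (Set.range
      (fun p : (j : ℕ) × (Fin (spinMult ι j) × Fin (2 * j + 1)) =>
        multiplet p.1 (h p.1 p.2.1 : Qubits ι) p.2.2)) with hWdef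
    have hin : ∀ j a (μ : Fin (2 * j + 1)), multiplet j (h j a : Qubits ι) μ ∈ W := fun j a μ =>
      Submodule.subset_span ⟨⟨j, a, μ⟩, rfl⟩
    have hperp : ∀ w : Qubits ι, w ∈ Wᗮ ↔
        ∀ j a (μ : Fin (2 * j + 1)), inner ℂ (multiplet j (h j a : Qubits ι) μ) w = 0 := by
      intro w
      rw [hWdef, Submodule.mem_orthogonal]
      constructor
      · intro hw j a μ
        exact hw _ (hin j a μ)
      · intro hw u hu
        induction hu using Submodule.span_induction with
        | mem u hu =>
          obtain ⟨p, rfl⟩ := hu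
          exact hw _ _ _
        | zero => exact inner_zero_left _
        | add u v _ _ h1 h2 => rw [inner_add_left, h1, h2, add_zero]
        | smul c u _ h1 => rw [inner_smul_left, h1, mul_zero]
    rw [← Submodule.orthogonal_eq_bot_iff]
    by_contra hbot
    -- The span is stable under `J_z` and `J_-`, so its orthogonal complement is stable under the
    -- adjoints `J_z` and `J_+`. A highest weight vector there would be orthogonal to a basis of its
    -- own highest weight space.
    obtain ⟨j, v, hvW, hv0, hv⟩ := exists_highestWeight hK hbot
      (fun v hv => (hperp _).2 fun j a μ => by
        rw [← inner_jz, jz_multiplet (hmem j a) (Nat.lt_succ_iff.1 μ.2), inner_smul_left,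
          (hperp v).1 hv, mul_zero])
      (fun v hv => (hperp _).2 fun j a μ => by
        rw [← inner_jminus]
        induction μ using Fin.cases with
        | zero => rw [Fin.val_zero, jminus_multiplet_zero (hmem j a), inner_zero_left]
        | succ μ => rw [hjm, inner_smul_left, (hperp v).1 hv, mul_zero])
    apply hv0
    have h1 : (⟨v, hv⟩ : highestWeight ι j) = 0 := by
      refine InnerProductSpace.ext_inner_left_basis (𝕜 := ℂ) (h j).toBasis fun a => ?_
      have := (hperp v).1 hvW j a (Fin.last _)
      rw [Fin.val_last, multiplet, Nat.sub_self, lower_zero, inner_smul_left] at this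
      simpa [lowerNormSq] using this
    exact congr_arg Subtype.val h1
  · intro j a μ
    rw [angJz_eq]
    exact jz_multiplet (hmem j a) (Nat.lt_succ_iff.1 μ.2)
  · intro j a
    rw [angJplus_eq]
    exact jplus_multiplet_last (hmem j a)
  · intro j a μ
    rw [angJplus_eq, Fin.val_castSucc, Fin.val_succ]
    exact jplus_multiplet (hmem j a) μ.2
  · intro j a
    rw [angJminus_eq]
    exact jminus_multiplet_zero (hmem j a)
  · intro j a μ
    rw [angJminus_eq]
    exact hjm j a μ

end AngularMomentumBasis

/-! ### Product vectors, partial inner products and the partial trace -/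

section Bipartite

variable {ι : Type} [Fintype ι] [DecidableEq ι] {S : Finset ι}

theorem prodVec_apply_glue (v : Qubits (BlockA S)) (w : Qubits (BlockB S))
    (x : BlockA S → Fin 2) (y : BlockB S → Fin 2) :
    prodVec S v w (glue S (x, y)) = v x * w y := by
  simp [prodVec]

theorem sum_glue {M : Type*} [AddCommMonoid M] (f : (ι → Fin 2) → M) :
    ∑ z, f z = ∑ x : BlockA S → Fin 2, ∑ y : BlockB S → Fin 2, f (glue S (x, y)) := by
  rw [← (glue S).sum_comp, Fintype.sum_prod_type]

theorem qubits_ext_glue {v w : Qubits ι}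
    (h : ∀ (x : BlockA S → Fin 2) (y : BlockB S → Fin 2), v (glue S (x, y)) = w (glue S (x, y))) :
    v = w := by
  ext z
  obtain ⟨⟨x, y⟩, rfl⟩ := (glue S).surjective z
  exact h x y

theorem glue_apply_mem (x : BlockA S → Fin 2) (y : BlockB S → Fin 2) (i : BlockA S) :
    glue S (x, y) i = x i := by
  simp [glue, Equiv.piEquivPiSubtypeProd]

theorem glue_apply_notMem (x : BlockA S → Fin 2) (y : BlockB S → Fin 2) (i : BlockB S) :
    glue S (x, y) i = y i := by
  simp [glue, Equiv.piEquivPiSubtypeProd, i.2]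

theorem update_glue_mem (x : BlockA S → Fin 2) (y : BlockB S → Fin 2) (i : BlockA S) (c : Fin 2) :
    Function.update (glue S (x, y)) i c = glue S (Function.update x i c, y) := by
  ext k : 1
  by_cases hk : k ∈ S
  · rw [glue_apply_mem _ _ ⟨k, hk⟩]
    by_cases hki : k = i
    · subst hki
      simp
    · rw [Function.update_of_ne hki, Function.update_of_ne (fun h => hki (congr_arg Subtype.val h)),
        glue_apply_mem _ _ ⟨k, hk⟩]
  · rw [glue_apply_notMem _ _ ⟨k, hk⟩, Function.update_of_ne (by rintro rfl; exact hk i.2),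
      glue_apply_notMem _ _ ⟨k, hk⟩]

theorem update_glue_notMem (x : BlockA S → Fin 2) (y : BlockB S → Fin 2) (i : BlockB S)
    (c : Fin 2) :
    Function.update (glue S (x, y)) i c = glue S (x, Function.update y i c) := by
  ext k : 1
  by_cases hk : k ∈ S
  · rw [glue_apply_mem _ _ ⟨k, hk⟩, Function.update_of_ne (by rintro rfl; exact i.2 hk),
      glue_apply_mem _ _ ⟨k, hk⟩]
  · rw [glue_apply_notMem _ _ ⟨k, hk⟩]
    by_cases hki : k = i
    · subst hki
      simp
    · rw [Function.update_of_ne hki, Function.update_of_ne (fun h => hki (congr_arg Subtype.val h)),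
        glue_apply_notMem _ _ ⟨k, hk⟩]

theorem collectiveHom_prodVec (s : Matrix (Fin 2) (Fin 2) ℂ) (v : Qubits (BlockA S))
    (w : Qubits (BlockB S)) :
    collectiveHom ι s (prodVec S v w) =
      prodVec S (collectiveHom _ s v) w + prodVec S v (collectiveHom _ s w) := by
  refine qubits_ext_glue (S := S) fun x y => ?_
  simp only [PiLp.add_apply, prodVec_apply_glue, collectiveHom_apply, collective_apply]
  rw [← Fintype.sum_subtype_add_sum_subtype (fun i => i ∈ S)]
  simp only [glue_apply_mem, update_glue_mem, glue_apply_notMem, update_glue_notMem,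
    prodVec_apply_glue]
  simp only [Finset.sum_mul, Finset.mul_sum]
  congr 1
  · refine Finset.sum_congr (by ext; simp) fun i _ => Finset.sum_congr rfl fun c _ => ?_
    ring
  · refine Finset.sum_congr rfl fun i _ => Finset.sum_congr rfl fun c _ => ?_
    ring

/-- The product vector as a bilinear map. -/
def prodVecHom (S : Finset ι) :
    Qubits (BlockA S) →ₗ[ℂ] Qubits (BlockB S) →ₗ[ℂ] Qubits ι :=
  LinearMap.mk₂ ℂ (prodVec S)
    (fun v v' w => by ext x; simp [prodVec, add_mul])
    (fun c v w => by ext x; simp [prodVec, mul_assoc])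
    (fun v w w' => by ext x; simp [prodVec, mul_add])
    (fun c v w => by ext x; simp [prodVec, mul_left_comm])

theorem prodVecHom_apply (v : Qubits (BlockA S)) (w : Qubits (BlockB S)) :
    prodVecHom S v w = prodVec S v w := rfl

theorem prodVec_zero_left (w : Qubits (BlockB S)) : prodVec S 0 w = 0 := by
  rw [← prodVecHom_apply, map_zero, LinearMap.zero_apply]

theorem prodVec_zero_right (v : Qubits (BlockA S)) : prodVec S v 0 = 0 := by
  rw [← prodVecHom_apply, map_zero]

theorem prodVec_smul_left (c : ℂ) (v : Qubits (BlockA S)) (w : Qubits (BlockB S)) :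
    prodVec S (c • v) w = c • prodVec S v w := by
  rw [← prodVecHom_apply, map_smul, LinearMap.smul_apply, prodVecHom_apply]

theorem prodVec_smul_right (c : ℂ) (v : Qubits (BlockA S)) (w : Qubits (BlockB S)) :
    prodVec S v (c • w) = c • prodVec S v w := by
  rw [← prodVecHom_apply, map_smul, prodVecHom_apply]

/-- The partial inner product `u ↦ ⟨u|ψ⟩` with vectors of block `A`, conjugate-linear in `u`. -/
def contract (S : Finset ι) (ψ : Qubits ι) : Qubits (BlockA S) →ₗ⋆[ℂ] Qubits (BlockB S) where
  toFun u := WithLp.toLp 2 fun y => ∑ x, star (u x) * ψ (glue S (x, y))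
  map_add' u v := by
    ext y
    simp [add_mul, Finset.sum_add_distrib]
  map_smul' c u := by
    ext y
    simp [Finset.mul_sum, mul_assoc]

theorem contract_apply (ψ : Qubits ι) (u : Qubits (BlockA S)) (y : BlockB S → Fin 2) :
    contract S ψ u y = ∑ x, star (u x) * ψ (glue S (x, y)) := rfl

theorem inner_prodVec_left (u : Qubits (BlockA S)) (w : Qubits (BlockB S)) (ψ : Qubits ι) :
    inner ℂ (prodVec S u w) ψ = inner ℂ w (contract S ψ u) := by
  rw [PiLp.inner_apply, PiLp.inner_apply, sum_glue (S := S), Finset.sum_comm]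
  refine Finset.sum_congr rfl fun y _ => ?_
  simp only [RCLike.inner_apply, prodVec_apply_glue, contract_apply, Finset.sum_mul, map_mul,
    starRingEnd_apply]
  refine Finset.sum_congr rfl fun x _ => ?_
  ring

theorem contract_prodVec (u v : Qubits (BlockA S)) (w : Qubits (BlockB S)) :
    contract S (prodVec S v w) u = inner ℂ u v • w := by
  ext y
  simp only [contract_apply, prodVec_apply_glue, PiLp.smul_apply, PiLp.inner_apply,
    RCLike.inner_apply, smul_eq_mul, Finset.sum_mul, starRingEnd_apply]
  refine Finset.sum_congr rfl fun x _ => ?_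
  ring

theorem inner_prodVec (u v : Qubits (BlockA S)) (w z : Qubits (BlockB S)) :
    inner ℂ (prodVec S u w) (prodVec S v z) = inner ℂ u v * inner ℂ w z := by
  rw [inner_prodVec_left, contract_prodVec, inner_smul_right]

theorem contract_single (ψ : Qubits ι) (x : BlockA S → Fin 2) (y : BlockB S → Fin 2) :
    contract S ψ (EuclideanSpace.single x 1) y = ψ (glue S (x, y)) := by
  rw [contract_apply, Finset.sum_eq_single x]
  · simp
  · intro x' _ hx'
    simp [hx']
  · simp

/-- The matrix elements of a reduced density matrix. -/
theorem inner_traceB (ψ : Qubits ι) (u v : Qubits (BlockA S)) :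
    inner ℂ u (Matrix.toEuclideanLin (traceB S (pureState ψ)) v) =
      inner ℂ (contract S ψ v) (contract S ψ u) := by
  have h1 : ∀ x, (Matrix.toEuclideanLin (traceB S (pureState ψ)) v) x =
      ∑ x', ∑ y, ψ (glue S (x, y)) * star (ψ (glue S (x', y))) * v x' := by
    intro x
    change ∑ x', traceB S (pureState ψ) x x' * v x' = _
    refine Finset.sum_congr rfl fun x' _ => ?_
    rw [traceB, Matrix.of_apply, Finset.sum_mul]
    rfl
  simp only [PiLp.inner_apply, RCLike.inner_apply, h1, contract_apply, starRingEnd_apply,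
    Finset.sum_mul, Finset.mul_sum, star_sum, star_mul', star_star]
  rw [Finset.sum_comm (s := (Finset.univ : Finset (BlockB S → Fin 2))), Finset.sum_comm]
  refine Finset.sum_congr rfl fun x _ => ?_
  rw [Finset.sum_comm]
  refine Finset.sum_congr rfl fun y _ => Finset.sum_congr rfl fun x' _ => ?_
  ring

end Bipartite

/-! ### Index types and ladder coefficients -/

section SpinIndex

variable {ι : Type} [Fintype ι] [DecidableEq ι]

/-- No eigenvalue of `J_z` exceeds half the number of qubits. This makes the label types finite
although `j` ranges over all naturals. -/
theorem spinMult_eq_zero {j : ℕ} (hj : Fintype.card ι < 2 * j) : spinMult ι j = 0 := by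
  rw [← finrank_highestWeight, Submodule.finrank_eq_zero, Submodule.eq_bot_iff]
  rintro v ⟨-, hv⟩
  by_contra h0
  obtain ⟨x, hx⟩ := jz_eigenvalue h0 hv
  have h1 : ((2 * (j + numOnes x) : ℕ) : ℂ) = (Fintype.card ι : ℕ) := by
    push_cast
    rw [hx]
    ring
  have := Nat.cast_injective h1
  omega

/-- The labels `(j, a, m)` of an angular momentum basis. -/
abbrev SpinIndex (ι : Type) [Fintype ι] [DecidableEq ι] : Type :=
  (j : ℕ) × (Fin (spinMult ι j) × Fin (2 * j + 1))

/-- A family of finite types of which only the first `K + 1` can be inhabited has a finite sum. -/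
@[reducible] def sigmaFintype {F : ℕ → Type} [∀ j, Fintype (F j)] (K : ℕ) (h : ∀ j, K < j → IsEmpty (F j)) :
    Fintype ((j : ℕ) × F j) where
  elems := (Finset.range (K + 1)).sigma fun _ => Finset.univ
  complete := by
    rintro ⟨j, p⟩
    rw [Finset.mem_sigma]
    refine ⟨Finset.mem_range.2 ?_, Finset.mem_univ _⟩
    by_contra! hj
    exact (h j hj).false p

theorem sum_sigma_eq {F : ℕ → Type} [∀ j, Fintype (F j)] [Fintype ((j : ℕ) × F j)] {K : ℕ}
    (h : ∀ j, K < j → IsEmpty (F j)) {M : Type*} [AddCommMonoid M] (f : (j : ℕ) × F j → M) :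
    ∑ p, f p = ∑ j ∈ Finset.range (K + 1), ∑ q : F j, f ⟨j, q⟩ := by
  rw [Finset.sum_sigma' (Finset.range (K + 1)) (fun _ => Finset.univ) fun j q => f ⟨j, q⟩]
  refine (Finset.sum_subset (Finset.subset_univ _) fun p _ hp => ?_).symm
  obtain ⟨j, q⟩ := p
  refine absurd ?_ hp
  rw [Finset.mem_sigma]
  refine ⟨Finset.mem_range.2 ?_, Finset.mem_univ _⟩
  by_contra! hj
  exact (h j hj).false q

theorem isEmpty_spinIndex {K j : ℕ} (hK : Fintype.card ι = 2 * K) (hj : K < j) :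
    IsEmpty (Fin (spinMult ι j)) := by
  rw [spinMult_eq_zero (by omega)]
  infer_instance

instance : Fintype (SpinIndex ι) :=
  sigmaFintype (Fintype.card ι) fun j hj => by
    rw [spinMult_eq_zero (by omega)]
    infer_instance

namespace IsAngularMomentumBasis

variable {e : (j : ℕ) → Fin (spinMult ι j) → Fin (2 * j + 1) → Qubits ι}

/-- An angular momentum basis as an orthonormal basis. -/
def toBasis (he : IsAngularMomentumBasis e) : OrthonormalBasis (SpinIndex ι) ℂ (Qubits ι) :=
  OrthonormalBasis.mk he.orthonormal he.span_eq_top.ge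

theorem toBasis_apply (he : IsAngularMomentumBasis e) (p : SpinIndex ι) :
    he.toBasis p = e p.1 p.2.1 p.2.2 :=
  congr_fun (OrthonormalBasis.coe_mk _ _) p

theorem norm_eq_one (he : IsAngularMomentumBasis e) (j a μ) : ‖e j a μ‖ = 1 :=
  he.orthonormal.1 ⟨j, a, μ⟩

theorem inner_eq_zero (he : IsAngularMomentumBasis e) {p q : SpinIndex ι} (h : p ≠ q) :
    inner ℂ (e p.1 p.2.1 p.2.2) (e q.1 q.2.1 q.2.2) = 0 :=
  he.orthonormal.2 h

theorem inner_eq_ite (he : IsAngularMomentumBasis e) (j a μ ν) :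
    inner ℂ (e j a μ) (e j a ν) = if μ = ν then 1 else 0 := by
  split_ifs with h
  · rw [h, inner_self_eq_norm_sq_to_K, he.norm_eq_one]
    simp
  · exact he.inner_eq_zero (p := ⟨j, a, μ⟩) (q := ⟨j, a, ν⟩) (by simpa using h)

theorem ext_inner (he : IsAngularMomentumBasis e) {v w : Qubits ι}
    (h : ∀ j a μ, inner ℂ (e j a μ) v = inner ℂ (e j a μ) w) : v = w := by
  refine InnerProductSpace.ext_inner_left_basis (𝕜 := ℂ) he.toBasis.toBasis fun p => ?_
  rw [OrthonormalBasis.coe_toBasis, toBasis_apply]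
  exact h _ _ _

theorem jz' (he : IsAngularMomentumBasis e) (j a) (μ : Fin (2 * j + 1)) :
    jzHom ι (e j a μ) = ((μ : ℂ) - (j : ℂ)) • e j a μ := by
  rw [← angJz_eq, he.jz]

end IsAngularMomentumBasis

/-- The matrix element of `J_±` between neighbouring states of spin `j`. -/
def ladder (j μ : ℕ) : ℂ := ((Real.sqrt ((2 * (j : ℝ) - (μ : ℝ)) * ((μ : ℝ) + 1)) : ℝ) : ℂ)

theorem ladder_ne_zero {j : ℕ} (μ : Fin (2 * j)) : ladder j μ ≠ 0 := by
  rw [ladder, Complex.ofReal_ne_zero, Real.sqrt_ne_zero']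
  have : ((μ : ℕ) : ℝ) < (2 * j : ℕ) := by exact_mod_cast μ.2
  push_cast at this
  exact mul_pos (by linarith) (by positivity)

/-- The reversal `μ ↦ 2j - 1 - μ` swaps the two factors under the root. This symmetry makes
neighbouring terms of a spin singlet cancel. -/
theorem ladder_rev {j : ℕ} (μ : Fin (2 * j)) : ladder j (μ.rev : Fin (2 * j)) = ladder j μ := by
  have h : (((μ.rev : Fin (2 * j)) : ℕ) : ℝ) = 2 * j - (μ + 1) := by
    rw [Fin.val_rev, Nat.cast_sub μ.2]
    push_cast
    ring
  rw [ladder, ladder, h]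
  congr 2
  ring

namespace IsAngularMomentumBasis

variable {e : (j : ℕ) → Fin (spinMult ι j) → Fin (2 * j + 1) → Qubits ι}

theorem jplus_last' (he : IsAngularMomentumBasis e) (j a) :
    jplusHom ι (e j a (Fin.last (2 * j))) = 0 := by
  rw [← angJplus_eq, he.jplus_last]

theorem jplus' (he : IsAngularMomentumBasis e) (j a) (μ : Fin (2 * j)) :
    jplusHom ι (e j a μ.castSucc) = ladder j μ • e j a μ.succ := by
  rw [← angJplus_eq, he.jplus, ladder]

theorem jminus_zero' (he : IsAngularMomentumBasis e) (j a) : jminusHom ι (e j a 0) = 0 := by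
  rw [← angJminus_eq, he.jminus_zero]

theorem jminus' (he : IsAngularMomentumBasis e) (j a) (μ : Fin (2 * j)) :
    jminusHom ι (e j a μ.succ) = ladder j μ • e j a μ.castSucc := by
  rw [← angJminus_eq, he.jminus, ladder]

end IsAngularMomentumBasis

end SpinIndex

/-! ### The spin singlets as an orthonormal basis of the invariant vectors -/

section SpinSinglets

variable {ι : Type} [Fintype ι] [DecidableEq ι] {S : Finset ι}
  {eA : (j : ℕ) → Fin (spinMult (BlockA S) j) → Fin (2 * j + 1) → Qubits (BlockA S)}
  {eB : (j : ℕ) → Fin (spinMult (BlockB S) j) → Fin (2 * j + 1) → Qubits (BlockB S)}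

theorem map_spinSinglet (j : ℕ) (u : Fin (2 * j + 1) → Qubits (BlockA S))
    (v : Fin (2 * j + 1) → Qubits (BlockB S)) (s : Matrix (Fin 2) (Fin 2) ℂ) :
    collectiveHom ι s (spinSinglet S j u v) = ((Real.sqrt (2 * (j : ℝ) + 1) : ℝ) : ℂ)⁻¹ •
      (∑ μ : Fin (2 * j + 1), ((-1 : ℂ) ^ (μ : ℕ)) • prodVec S (collectiveHom _ s (u μ.rev)) (v μ) +
      ∑ μ : Fin (2 * j + 1), ((-1 : ℂ) ^ (μ : ℕ)) •
        prodVec S (u μ.rev) (collectiveHom _ s (v μ))) := by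
  simp only [spinSinglet, map_smul, map_sum, collectiveHom_prodVec, smul_add,
    Finset.sum_add_distrib]

/-- For `J_z` the weights `-m` and `m` cancel. For `J_±` the action on `A` in one term cancels the
action on `B` in the neighbouring one, by the alternating sign and equal ladder coefficients; the
unpaired end terms are annihilated. -/
theorem spinSinglet_mem (hA : IsAngularMomentumBasis eA) (hB : IsAngularMomentumBasis eB)
    (j : ℕ) (a : Fin (spinMult (BlockA S) j)) (b : Fin (spinMult (BlockB S) j)) :
    spinSinglet S j (eA j a) (eB j b) ∈ singletSpace ι := by
  rw [mem_singletSpace_iff]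
  refine ⟨?_, ?_, ?_⟩
  · refine (map_spinSinglet _ _ _ _).trans ?_
    change _ • (∑ μ : Fin (2 * j + 1), ((-1 : ℂ) ^ (μ : ℕ)) •
        prodVec S (jzHom _ (eA j a μ.rev)) (eB j b μ) +
      ∑ μ : Fin (2 * j + 1), ((-1 : ℂ) ^ (μ : ℕ)) •
        prodVec S (eA j a μ.rev) (jzHom _ (eB j b μ))) = 0
    rw [← Finset.sum_add_distrib, Finset.sum_eq_zero, smul_zero]
    intro μ _
    rw [hA.jz', hB.jz', prodVec_smul_left, prodVec_smul_right, ← smul_add, ← add_smul]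
    have : ((μ.rev : Fin (2 * j + 1)) : ℕ) + (μ : ℕ) = 2 * j := by
      rw [Fin.val_rev]
      omega
    have h2 : (((μ.rev : Fin (2 * j + 1)) : ℕ) : ℂ) + ((μ : ℕ) : ℂ) = 2 * j := by exact_mod_cast this
    rw [show (((μ.rev : Fin (2 * j + 1)) : ℕ) : ℂ) - j + (((μ : ℕ) : ℂ) - j) = 0 by
      linear_combination h2, zero_smul, smul_zero]
  · refine (map_spinSinglet _ _ _ _).trans ?_
    change _ • (∑ μ : Fin (2 * j + 1), ((-1 : ℂ) ^ (μ : ℕ)) •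
        prodVec S (jplusHom _ (eA j a μ.rev)) (eB j b μ) +
      ∑ μ : Fin (2 * j + 1), ((-1 : ℂ) ^ (μ : ℕ)) •
        prodVec S (eA j a μ.rev) (jplusHom _ (eB j b μ))) = 0
    rw [Fin.sum_univ_succ, Fin.sum_univ_castSucc (n := 2 * j) (f := fun μ => ((-1 : ℂ) ^ (μ : ℕ)) •
      prodVec S (eA j a μ.rev) (jplusHom _ (eB j b μ))), Fin.rev_zero, hA.jplus_last',
      hB.jplus_last', prodVec_zero_left, prodVec_zero_right, smul_zero, smul_zero, zero_add,
      add_zero, ← Finset.sum_add_distrib, Finset.sum_eq_zero, smul_zero]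
    intro μ _
    rw [Fin.rev_succ, Fin.rev_castSucc, hA.jplus', hB.jplus', prodVec_smul_left,
      prodVec_smul_right, ladder_rev, Fin.val_succ, Fin.val_castSucc, pow_succ]
    module
  · refine (map_spinSinglet _ _ _ _).trans ?_
    change _ • (∑ μ : Fin (2 * j + 1), ((-1 : ℂ) ^ (μ : ℕ)) •
        prodVec S (jminusHom _ (eA j a μ.rev)) (eB j b μ) +
      ∑ μ : Fin (2 * j + 1), ((-1 : ℂ) ^ (μ : ℕ)) •
        prodVec S (eA j a μ.rev) (jminusHom _ (eB j b μ))) = 0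
    rw [Fin.sum_univ_castSucc, Fin.sum_univ_succ (n := 2 * j) (f := fun μ => ((-1 : ℂ) ^ (μ : ℕ)) •
      prodVec S (eA j a μ.rev) (jminusHom _ (eB j b μ))), Fin.rev_last, hA.jminus_zero',
      hB.jminus_zero', prodVec_zero_left, prodVec_zero_right, smul_zero, smul_zero, zero_add,
      add_zero, ← Finset.sum_add_distrib, Finset.sum_eq_zero, smul_zero]
    intro μ _
    rw [Fin.rev_succ, Fin.rev_castSucc, hA.jminus', hB.jminus', prodVec_smul_left,
      prodVec_smul_right, ladder_rev, Fin.val_succ, Fin.val_castSucc, pow_succ]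
    module

theorem two_mul_add_one_ne_zero (j : ℕ) : 2 * (j : ℂ) + 1 ≠ 0 := by
  exact_mod_cast Nat.succ_ne_zero (2 * j)

theorem sqrt_two_mul_add_one_mul_self (j : ℕ) :
    ((Real.sqrt (2 * (j : ℝ) + 1) : ℝ) : ℂ) * ((Real.sqrt (2 * (j : ℝ) + 1) : ℝ) : ℂ) =
      2 * j + 1 := by
  rw [← Complex.ofReal_mul, Real.mul_self_sqrt (by positivity)]
  push_cast
  rfl

theorem inner_spinSinglet_left (j : ℕ) (u : Fin (2 * j + 1) → Qubits (BlockA S))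
    (v : Fin (2 * j + 1) → Qubits (BlockB S)) (ψ : Qubits ι) :
    inner ℂ (spinSinglet S j u v) ψ = ((Real.sqrt (2 * (j : ℝ) + 1) : ℝ) : ℂ)⁻¹ *
      ∑ μ : Fin (2 * j + 1), (-1 : ℂ) ^ (μ : ℕ) * inner ℂ (prodVec S (u μ.rev) (v μ)) ψ := by
  rw [spinSinglet, inner_smul_left, sum_inner]
  congr 1
  · rw [map_inv₀, Complex.conj_ofReal]
  · refine Finset.sum_congr rfl fun μ _ => ?_
    rw [inner_smul_left]
    congr 1
    simp

theorem inner_spinSinglet_spinSinglet (j j' : ℕ) (u : Fin (2 * j + 1) → Qubits (BlockA S))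
    (v : Fin (2 * j + 1) → Qubits (BlockB S)) (u' : Fin (2 * j' + 1) → Qubits (BlockA S))
    (v' : Fin (2 * j' + 1) → Qubits (BlockB S)) :
    inner ℂ (spinSinglet S j u v) (spinSinglet S j' u' v') =
      ((Real.sqrt (2 * (j : ℝ) + 1) : ℝ) : ℂ)⁻¹ * (((Real.sqrt (2 * (j' : ℝ) + 1) : ℝ) : ℂ)⁻¹ *
      ∑ μ : Fin (2 * j + 1), ∑ ν : Fin (2 * j' + 1), (-1 : ℂ) ^ (μ : ℕ) * ((-1 : ℂ) ^ (ν : ℕ) *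
        (inner ℂ (u μ.rev) (u' ν.rev) * inner ℂ (v μ) (v' ν)))) := by
  rw [inner_spinSinglet_left]
  congr 1
  rw [Finset.mul_sum]
  refine Finset.sum_congr rfl fun μ _ => ?_
  rw [spinSinglet, inner_smul_right, inner_sum, ← Finset.mul_sum, mul_left_comm]
  congr 2
  refine Finset.sum_congr rfl fun ν _ => ?_
  rw [inner_smul_right, inner_prodVec]

/-- The labels `(j, a, b)` of the spin singlets. -/
abbrev SingletIndex (S : Finset ι) : Type :=
  (j : ℕ) × (Fin (spinMult (BlockA S) j) × Fin (spinMult (BlockB S) j))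

instance : Fintype (SingletIndex S) :=
  sigmaFintype (Fintype.card (BlockA S)) fun j hj => by
    rw [spinMult_eq_zero (ι := BlockA S) (by omega)]
    infer_instance

/-- The spin singlet with label `p`. -/
def singletVec (eA : (j : ℕ) → Fin (spinMult (BlockA S) j) → Fin (2 * j + 1) → Qubits (BlockA S))
    (eB : (j : ℕ) → Fin (spinMult (BlockB S) j) → Fin (2 * j + 1) → Qubits (BlockB S))
    (p : SingletIndex S) : Qubits ι :=
  spinSinglet S p.1 (eA p.1 p.2.1) (eB p.1 p.2.2)

theorem orthonormal_singletVec (hA : IsAngularMomentumBasis eA) (hB : IsAngularMomentumBasis eB) :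
    Orthonormal ℂ (singletVec eA eB) := by
  constructor
  · rintro ⟨j, a, b⟩
    have h : inner ℂ (singletVec eA eB ⟨j, a, b⟩) (singletVec eA eB ⟨j, a, b⟩) = (1 : ℂ) := by
      rw [singletVec, inner_spinSinglet_spinSinglet]
      have h1 : ∀ μ ν : Fin (2 * j + 1), (-1 : ℂ) ^ (μ : ℕ) * ((-1 : ℂ) ^ (ν : ℕ) *
          (inner ℂ (eA j a μ.rev) (eA j a ν.rev) * inner ℂ (eB j b μ) (eB j b ν))) =
          if μ = ν then 1 else 0 := by
        intro μ ν
        rw [hA.inner_eq_ite, hB.inner_eq_ite]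
        split_ifs with h2 h3 h3
        · subst h3
          rw [mul_one, mul_one, ← mul_pow]
          simp
        · simp
        · exact absurd (congr_arg Fin.rev h3) h2
        · simp
      simp only [h1, Finset.sum_ite_eq, Finset.mem_univ, if_true, Finset.sum_const,
        Finset.card_univ, Fintype.card_fin, nsmul_eq_mul, mul_one]
      rw [← mul_assoc, ← mul_inv, sqrt_two_mul_add_one_mul_self]
      push_cast
      exact inv_mul_cancel₀ (two_mul_add_one_ne_zero j)
    rw [inner_self_eq_norm_sq_to_K] at h
    have h2 : ‖singletVec eA eB ⟨j, a, b⟩‖ ^ 2 = 1 := by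
      apply Complex.ofReal_injective
      rw [Complex.ofReal_pow, Complex.ofReal_one]
      exact h
    exact (pow_eq_one_iff_of_nonneg (norm_nonneg _) two_ne_zero).1 h2
  · rintro ⟨j, a, b⟩ ⟨j', a', b'⟩ hne
    rw [singletVec, singletVec, inner_spinSinglet_spinSinglet]
    simp only [Finset.mul_sum]
    refine Finset.sum_eq_zero fun μ _ => Finset.sum_eq_zero fun ν _ => ?_
    by_cases h1 : (⟨j, a, μ.rev⟩ : SpinIndex (BlockA S)) = ⟨j', a', ν.rev⟩
    · by_cases h2 : (⟨j, b, μ⟩ : SpinIndex (BlockB S)) = ⟨j', b', ν⟩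
      · refine absurd ?_ hne
        obtain ⟨hj, h3⟩ := Sigma.mk.inj h1
        subst hj
        obtain ⟨_, h4⟩ := Sigma.mk.inj h2
        rw [(Prod.mk.inj (eq_of_heq h3)).1, (Prod.mk.inj (eq_of_heq h4)).1]
      · have := hB.inner_eq_zero h2
        dsimp only at this
        rw [this]
        simp
    · have := hA.inner_eq_zero h1
      dsimp only at this
      rw [this]
      simp

/-- The adjoint `J_-` annihilates `ψ`. With its analogues for `J_-` and `J_z`, this yields all the
relations between the coefficients of `ψ` in a product basis. -/
theorem inner_jplus_prodVec {ψ : Qubits ι} (hψ : ψ ∈ singletSpace ι) (u : Qubits (BlockA S))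
    (w : Qubits (BlockB S)) :
    inner ℂ (prodVec S (jplusHom _ u) w) ψ + inner ℂ (prodVec S u (jplusHom _ w)) ψ = 0 := by
  rw [← inner_add_left, jplusHom, jplusHom, ← collectiveHom_prodVec, ← jplusHom, inner_jplus,
    (mem_singletSpace_iff.1 hψ).2.2, inner_zero_right]

theorem inner_jminus_prodVec {ψ : Qubits ι} (hψ : ψ ∈ singletSpace ι) (u : Qubits (BlockA S))
    (w : Qubits (BlockB S)) :
    inner ℂ (prodVec S (jminusHom _ u) w) ψ + inner ℂ (prodVec S u (jminusHom _ w)) ψ = 0 := by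
  rw [← inner_add_left, jminusHom, jminusHom, ← collectiveHom_prodVec, ← jminusHom, inner_jminus,
    (mem_singletSpace_iff.1 hψ).2.1, inner_zero_right]

theorem inner_jz_prodVec {ψ : Qubits ι} (hψ : ψ ∈ singletSpace ι) (u : Qubits (BlockA S))
    (w : Qubits (BlockB S)) :
    inner ℂ (prodVec S (jzHom _ u) w) ψ + inner ℂ (prodVec S u (jzHom _ w)) ψ = 0 := by
  rw [← inner_add_left, jzHom, jzHom, ← collectiveHom_prodVec, ← jzHom, inner_jz,
    (mem_singletSpace_iff.1 hψ).1, inner_zero_right]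

/-- Neighbouring coefficients of an invariant vector in the product of angular momentum bases. -/
theorem coeff_step {ψ : Qubits ι} (hψ : ψ ∈ singletSpace ι) (hA : IsAngularMomentumBasis eA)
    (hB : IsAngularMomentumBasis eB) {j j' : ℕ} (a : Fin (spinMult (BlockA S) j))
    (b : Fin (spinMult (BlockB S) j')) (μ : Fin (2 * j)) (ν : Fin (2 * j')) :
    ladder j μ * inner ℂ (prodVec S (eA j a μ.castSucc) (eB j' b ν.succ)) ψ =
      -(ladder j' ν * inner ℂ (prodVec S (eA j a μ.succ) (eB j' b ν.castSucc)) ψ) := by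
  have h := inner_jminus_prodVec hψ (eA j a μ.succ) (eB j' b ν.succ)
  rw [hA.jminus', hB.jminus', prodVec_smul_left, prodVec_smul_right, inner_smul_left,
    inner_smul_left] at h
  simp only [ladder, Complex.conj_ofReal] at h ⊢
  exact eq_neg_of_add_eq_zero_left h

theorem coeff_castSucc_zero {ψ : Qubits ι} (hψ : ψ ∈ singletSpace ι)
    (hA : IsAngularMomentumBasis eA) (hB : IsAngularMomentumBasis eB) {j j' : ℕ}
    (a : Fin (spinMult (BlockA S) j)) (b : Fin (spinMult (BlockB S) j')) (μ : Fin (2 * j)) :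
    inner ℂ (prodVec S (eA j a μ.castSucc) (eB j' b 0)) ψ = 0 := by
  have h := inner_jminus_prodVec hψ (eA j a μ.succ) (eB j' b 0)
  rw [hA.jminus', hB.jminus_zero', prodVec_smul_left, prodVec_zero_right, inner_smul_left,
    inner_zero_left, add_zero] at h
  refine (mul_eq_zero.1 h).resolve_left ?_
  simpa using ladder_ne_zero μ

theorem coeff_last_succ {ψ : Qubits ι} (hψ : ψ ∈ singletSpace ι)
    (hA : IsAngularMomentumBasis eA) (hB : IsAngularMomentumBasis eB) {j j' : ℕ}
    (a : Fin (spinMult (BlockA S) j)) (b : Fin (spinMult (BlockB S) j')) (ν : Fin (2 * j')) :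
    inner ℂ (prodVec S (eA j a (Fin.last _)) (eB j' b ν.succ)) ψ = 0 := by
  have h := inner_jplus_prodVec hψ (eA j a (Fin.last _)) (eB j' b ν.castSucc)
  rw [hA.jplus_last', hB.jplus', prodVec_smul_right, prodVec_zero_left, inner_smul_left,
    inner_zero_left, zero_add] at h
  refine (mul_eq_zero.1 h).resolve_left ?_
  simpa using ladder_ne_zero ν

theorem coeff_last_zero_of_ne {ψ : Qubits ι} (hψ : ψ ∈ singletSpace ι)
    (hA : IsAngularMomentumBasis eA) (hB : IsAngularMomentumBasis eB) {j j' : ℕ} (hj : j ≠ j')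
    (a : Fin (spinMult (BlockA S) j)) (b : Fin (spinMult (BlockB S) j')) :
    inner ℂ (prodVec S (eA j a (Fin.last _)) (eB j' b 0)) ψ = 0 := by
  have h := inner_jz_prodVec hψ (eA j a (Fin.last _)) (eB j' b 0)
  rw [hA.jz', hB.jz', prodVec_smul_left, prodVec_smul_right, inner_smul_left, inner_smul_left,
    ← add_mul] at h
  refine (mul_eq_zero.1 h).resolve_left ?_
  intro h0
  apply hj
  simp only [Fin.val_last, Fin.val_zero, Nat.cast_mul, Nat.cast_ofNat, Nat.cast_zero, map_sub,
    map_mul, Complex.conj_natCast, Complex.conj_ofNat, map_zero] at h0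
  have : (j : ℂ) = j' := by linear_combination h0
  exact_mod_cast this

/-- Schur's lemma for distinct spins. The corner coefficient (top of `A`, bottom of `B`) vanishes
because the weights `j` and `-j'` do not add up to zero, and the ladder recursion carries the zero
to the whole table. -/
theorem coeff_of_ne {ψ : Qubits ι} (hψ : ψ ∈ singletSpace ι) (hA : IsAngularMomentumBasis eA)
    (hB : IsAngularMomentumBasis eB) {j j' : ℕ} (hj : j ≠ j') (a : Fin (spinMult (BlockA S) j))
    (b : Fin (spinMult (BlockB S) j')) (μ : Fin (2 * j + 1)) (ν : Fin (2 * j' + 1)) :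
    inner ℂ (prodVec S (eA j a μ) (eB j' b ν)) ψ = 0 := by
  induction μ using Fin.reverseInduction generalizing ν with
  | last =>
    induction ν using Fin.cases with
    | zero => exact coeff_last_zero_of_ne hψ hA hB hj a b
    | succ ν => exact coeff_last_succ hψ hA hB a b ν
  | cast μ ih =>
    induction ν using Fin.cases with
    | zero => exact coeff_castSucc_zero hψ hA hB a b μ
    | succ ν =>
      have h := coeff_step hψ hA hB a b μ ν
      rw [ih, mul_zero, neg_zero] at h
      exact (mul_eq_zero.1 h).resolve_left (ladder_ne_zero μ)

/-- Schur's lemma for equal spins: the same recursion leaves one free number, the corner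
coefficient, which propagates along the antidiagonal with alternating sign. -/
theorem coeff_eq_ite {ψ : Qubits ι} (hψ : ψ ∈ singletSpace ι) (hA : IsAngularMomentumBasis eA)
    (hB : IsAngularMomentumBasis eB) {j : ℕ} (a : Fin (spinMult (BlockA S) j))
    (b : Fin (spinMult (BlockB S) j)) (μ ν : Fin (2 * j + 1)) :
    inner ℂ (prodVec S (eA j a μ) (eB j b ν)) ψ = if ν = μ.rev then
      (-1 : ℂ) ^ (ν : ℕ) * inner ℂ (prodVec S (eA j a (Fin.last _)) (eB j b 0)) ψ else 0 := by
  induction μ using Fin.reverseInduction generalizing ν with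
  | last =>
    rw [Fin.rev_last]
    induction ν using Fin.cases with
    | zero => simp
    | succ ν => rw [coeff_last_succ hψ hA hB a b ν, if_neg (Fin.succ_ne_zero ν)]
  | cast μ ih =>
    rw [Fin.rev_castSucc]
    induction ν using Fin.cases with
    | zero => rw [coeff_castSucc_zero hψ hA hB a b μ, if_neg (Fin.succ_ne_zero _).symm]
    | succ ν =>
      have h := coeff_step hψ hA hB a b μ ν
      rw [ih, Fin.rev_succ] at h
      simp only [Fin.castSucc_inj, Fin.succ_inj] at h ⊢
      apply mul_left_cancel₀ (ladder_ne_zero μ)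
      rw [h]
      split_ifs with hν
      · rw [hν, ladder_rev, Fin.val_castSucc, Fin.val_succ, pow_succ]
        ring
      · simp

theorem coeff_eq_inner_singletVec {ψ : Qubits ι} (hψ : ψ ∈ singletSpace ι)
    (hA : IsAngularMomentumBasis eA) (hB : IsAngularMomentumBasis eB) {j : ℕ}
    (a : Fin (spinMult (BlockA S) j)) (b : Fin (spinMult (BlockB S) j)) (μ ν : Fin (2 * j + 1)) :
    inner ℂ (prodVec S (eA j a μ) (eB j b ν)) ψ = if ν = μ.rev then
      (-1 : ℂ) ^ (ν : ℕ) * (((Real.sqrt (2 * (j : ℝ) + 1) : ℝ) : ℂ)⁻¹ *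
        inner ℂ (singletVec eA eB ⟨j, a, b⟩) ψ) else 0 := by
  rw [coeff_eq_ite hψ hA hB]
  congr 2
  rw [singletVec, inner_spinSinglet_left]
  have h : ∀ μ : Fin (2 * j + 1), (-1 : ℂ) ^ (μ : ℕ) *
      inner ℂ (prodVec S (eA j a μ.rev) (eB j b μ)) ψ =
        inner ℂ (prodVec S (eA j a (Fin.last _)) (eB j b 0)) ψ := by
    intro μ
    rw [coeff_eq_ite hψ hA hB, Fin.rev_rev, if_pos rfl, ← mul_assoc, ← mul_pow]
    simp
  simp only [h, Finset.sum_const, Finset.card_univ, Fintype.card_fin,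
    nsmul_eq_mul]
  rw [← mul_assoc, ← mul_inv, sqrt_two_mul_add_one_mul_self]
  push_cast
  rw [inv_mul_cancel_left₀ (two_mul_add_one_ne_zero j)]

theorem eq_zero_of_inner_prodVec (hA : IsAngularMomentumBasis eA)
    (hB : IsAngularMomentumBasis eB) {ψ : Qubits ι}
    (h : ∀ j a μ j' b ν, inner ℂ (prodVec S (eA j a μ) (eB j' b ν)) ψ = 0) : ψ = 0 := by
  have h1 : ∀ j a μ, contract S ψ (eA j a μ) = 0 := by
    intro j a μ
    refine hB.ext_inner fun j' b ν => ?_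
    rw [← inner_prodVec_left, h, inner_zero_right]
  have h2 : ∀ u, contract S ψ u = 0 := by
    intro u
    rw [← hA.toBasis.sum_repr u, map_sum]
    refine Finset.sum_eq_zero fun p _ => ?_
    rw [map_smulₛₗ, hA.toBasis_apply, h1, smul_zero]
  refine qubits_ext_glue (S := S) fun x y => ?_
  rw [← contract_single, h2]
  rfl

theorem eq_zero_of_inner_singletVec {ψ : Qubits ι} (hψ : ψ ∈ singletSpace ι)
    (hA : IsAngularMomentumBasis eA) (hB : IsAngularMomentumBasis eB)
    (h : ∀ p, inner ℂ (singletVec eA eB p) ψ = 0) : ψ = 0 := by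
  refine eq_zero_of_inner_prodVec hA hB fun j a μ j' b ν => ?_
  by_cases hj : j = j'
  · subst hj
    rw [coeff_eq_inner_singletVec hψ hA hB, h]
    simp
  · exact coeff_of_ne hψ hA hB hj a b μ ν

theorem singletVec_mem (hA : IsAngularMomentumBasis eA) (hB : IsAngularMomentumBasis eB)
    (p : SingletIndex S) : singletVec eA eB p ∈ singletSpace ι :=
  spinSinglet_mem hA hB p.1 p.2.1 p.2.2

/-- The spin singlets form an orthonormal basis of the space of invariant vectors. -/
def singletBasis (hA : IsAngularMomentumBasis eA) (hB : IsAngularMomentumBasis eB) :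
    OrthonormalBasis (SingletIndex S) ℂ (singletSpace ι) :=
  OrthonormalBasis.mkOfOrthogonalEqBot
    (v := fun p => (⟨singletVec eA eB p, singletVec_mem hA hB p⟩ : singletSpace ι))
    (by
      rw [← (singletSpace ι).subtypeₗᵢ.orthonormal_comp_iff]
      exact orthonormal_singletVec hA hB)
    (by
      rw [Submodule.eq_bot_iff]
      intro ψ hψ
      refine Subtype.ext (eq_zero_of_inner_singletVec ψ.2 hA hB fun p => ?_)
      exact (Submodule.mem_orthogonal _ _).1 hψ _ (Submodule.subset_span ⟨p, rfl⟩))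

theorem singletBasis_apply (hA : IsAngularMomentumBasis eA) (hB : IsAngularMomentumBasis eB)
    (p : SingletIndex S) : (singletBasis hA hB p : Qubits ι) = singletVec eA eB p := by
  rw [singletBasis, OrthonormalBasis.coe_of_orthogonal_eq_bot_mk]

theorem card_singletIndex (hA : IsAngularMomentumBasis eA) (hB : IsAngularMomentumBasis eB) :
    Fintype.card (SingletIndex S) = Module.finrank ℂ (singletSpace ι) :=
  (Module.finrank_eq_card_basis (singletBasis hA hB).toBasis).symm

/-- The maximally mixed invariant state is the uniform mixture of the spin singlets. -/
theorem singletState_eq_sum (hA : IsAngularMomentumBasis eA) (hB : IsAngularMomentumBasis eB) :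
    singletState ι = ((Module.finrank ℂ (singletSpace ι) : ℂ))⁻¹ •
      ∑ p : SingletIndex S, pureState (singletVec eA eB p) := by
  rw [singletState]
  congr 1
  rw [LinearEquiv.symm_apply_eq, (singletBasis hA hB).starProjection_eq_sum_rankOne]
  ext v x
  rw [map_sum, LinearMap.sum_apply]
  simp only [ContinuousLinearMap.coe_coe, sum_apply, InnerProductSpace.rankOne_apply,
    singletBasis_apply, WithLp.ofLp_sum, Finset.sum_apply]
  refine Finset.sum_congr rfl fun p _ => ?_
  change _ = ∑ y, (singletVec eA eB p x * star (singletVec eA eB p y)) * v y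
  rw [PiLp.smul_apply, PiLp.inner_apply, smul_eq_mul, Finset.sum_mul]
  refine Finset.sum_congr rfl fun y _ => ?_
  rw [RCLike.inner_apply, starRingEnd_apply]
  ring

end SpinSinglets

/-! ### Entropy bounds from eigenvalues -/

section Entropy

variable {m : Type} [Fintype m] [DecidableEq m] {M : Matrix m m ℂ}

/-- The entropy in terms of the eigenvalues. -/
theorem vonNeumannEntropy_eq_sum (hM : M.IsHermitian) :
    vonNeumannEntropy M = ∑ i, -(hM.eigenvalues i * Real.log (hM.eigenvalues i)) := by
  have h1 : M * cfc Real.log M = Unitary.conjStarAlgAut ℂ _ hM.eigenvectorUnitary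
      (Matrix.diagonal fun i =>
        ((hM.eigenvalues i * Real.log (hM.eigenvalues i) : ℝ) : ℂ)) := by
    rw [hM.cfc_eq, Matrix.IsHermitian.cfc]
    nth_rewrite 1 [hM.spectral_theorem]
    rw [← map_mul, Matrix.diagonal_mul_diagonal]
    congr 2
    ext i
    simp
  rw [vonNeumannEntropy, h1, Unitary.conjStarAlgAut_apply, Matrix.trace_mul_cycle,
    Unitary.coe_star_mul_self, one_mul, Matrix.trace_diagonal, ← Complex.ofReal_sum,
    ← Complex.ofReal_neg, Complex.ofReal_re, Finset.sum_neg_distrib]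

theorem toEuclideanLin_eigenvectorBasis (hM : M.IsHermitian) (i : m) :
    Matrix.toEuclideanLin M (hM.eigenvectorBasis i) =
      ((hM.eigenvalues i : ℝ) : ℂ) • hM.eigenvectorBasis i := by
  ext x
  have := congr_fun (hM.mulVec_eigenvectorBasis i) x
  exact this

/-- The entropy of a normalized multiple of a projection. -/
theorem vonNeumannEntropy_of_sq (hM : M.IsHermitian) {c : ℝ} (hsq : M * M = (c : ℂ) • M)
    (htr : M.trace = 1) : vonNeumannEntropy M = -Real.log c := by
  have h1 : ∀ i, hM.eigenvalues i = 0 ∨ hM.eigenvalues i = c := by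
    intro i
    have h2 := hM.mulVec_eigenvectorBasis i
    have h3 : (M * M) *ᵥ (WithLp.ofLp (hM.eigenvectorBasis i)) =
        hM.eigenvalues i • hM.eigenvalues i • WithLp.ofLp (hM.eigenvectorBasis i) := by
      rw [← Matrix.mulVec_mulVec, h2, Matrix.mulVec_smul, h2]
    rw [hsq, Matrix.smul_mulVec, h2] at h3
    have hne : hM.eigenvectorBasis i ≠ 0 := hM.eigenvectorBasis.toBasis.ne_zero i
    obtain ⟨x, hx⟩ : ∃ x, hM.eigenvectorBasis i x ≠ 0 := by
      by_contra! h0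
      exact hne (by ext x; exact h0 x)
    have h4 := congr_fun h3 x
    simp only [Pi.smul_apply, Complex.real_smul, smul_eq_mul, ← mul_assoc] at h4
    have h5 := mul_right_cancel₀ hx h4
    have h6 : c * hM.eigenvalues i = hM.eigenvalues i * hM.eigenvalues i := by
      apply Complex.ofReal_injective
      rw [Complex.ofReal_mul, Complex.ofReal_mul]
      exact h5
    rcases eq_or_ne (hM.eigenvalues i) 0 with h7 | h7
    · exact Or.inl h7
    · exact Or.inr (mul_right_cancel₀ h7 h6).symm
  have h2 : ∑ i, hM.eigenvalues i = 1 := by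
    have := hM.trace_eq_sum_eigenvalues
    rw [htr] at this
    apply Complex.ofReal_injective
    rw [Complex.ofReal_sum, Complex.ofReal_one]
    exact this.symm
  rw [vonNeumannEntropy_eq_sum hM]
  trans ∑ i, hM.eigenvalues i * (-Real.log c)
  · refine Finset.sum_congr rfl fun i _ => ?_
    rcases h1 i with h | h <;> rw [h] <;> simp
  · rw [← Finset.sum_mul, h2, one_mul]

/-- If every eigenvector that meets `b α` has an eigenvalue at most `exp (-ℓ α)`, then the entropy
is at least the expectation of `ℓ`. -/
theorem le_vonNeumannEntropy {α : Type*} [Fintype α] (hM : M.IsHermitian)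
    (hpos : ∀ u : EuclideanSpace ℂ m, 0 ≤ (inner ℂ u (Matrix.toEuclideanLin M u)).re)
    (b : OrthonormalBasis α ℂ (EuclideanSpace ℂ m)) (ℓ : α → ℝ)
    (hb : ∀ (φ : EuclideanSpace ℂ m) (r : ℝ), Matrix.toEuclideanLin M φ = (r : ℂ) • φ →
      ∀ p, inner ℂ (b p) φ ≠ 0 → r ≤ Real.exp (-ℓ p)) :
    ∑ p, ℓ p * (inner ℂ (b p) (Matrix.toEuclideanLin M (b p))).re ≤ vonNeumannEntropy M := by
  have hev := toEuclideanLin_eigenvectorBasis hM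
  have h0 : ∀ i, 0 ≤ hM.eigenvalues i := by
    intro i
    have := hpos (hM.eigenvectorBasis i)
    rw [hev, inner_smul_right, inner_self_eq_norm_sq_to_K, hM.eigenvectorBasis.norm_eq_one] at this
    simpa using this
  have h1 : ∀ p, (inner ℂ (b p) (Matrix.toEuclideanLin M (b p))).re =
      ∑ i, hM.eigenvalues i * ‖inner ℂ (b p) (hM.eigenvectorBasis i)‖ ^ 2 := by
    intro p
    have hsymm := Matrix.isSymmetric_toEuclideanLin_iff.2 hM
    rw [← hM.eigenvectorBasis.sum_inner_mul_inner, Complex.re_sum]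
    refine Finset.sum_congr rfl fun i _ => ?_
    rw [← hsymm, hev, inner_smul_left, Complex.conj_ofReal, mul_left_comm,
      ← inner_conj_symm (hM.eigenvectorBasis i), Complex.mul_conj', ← Complex.ofReal_pow,
      ← Complex.ofReal_mul, Complex.ofReal_re]
  rw [vonNeumannEntropy_eq_sum hM]
  simp only [h1, Finset.mul_sum]
  rw [Finset.sum_comm]
  refine Finset.sum_le_sum fun i _ => ?_
  -- A zero eigenvalue contributes nothing to either side; a positive one admits the logarithm, and
  -- the comparison is made separately for each eigenvalue.
  rcases (h0 i).eq_or_lt with hi | hi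
  · simp [← hi]
  have hn : ∑ p, ‖inner ℂ (b p) (hM.eigenvectorBasis i)‖ ^ 2 = 1 := by
    rw [b.sum_sq_norm_inner_right, hM.eigenvectorBasis.norm_eq_one, one_pow]
  calc ∑ p, ℓ p * (hM.eigenvalues i * ‖inner ℂ (b p) (hM.eigenvectorBasis i)‖ ^ 2)
      ≤ ∑ p, -(hM.eigenvalues i * Real.log (hM.eigenvalues i)) *
          ‖inner ℂ (b p) (hM.eigenvectorBasis i)‖ ^ 2 := by
        refine Finset.sum_le_sum fun p _ => ?_
        rcases eq_or_ne (inner ℂ (b p) (hM.eigenvectorBasis i)) 0 with hp | hp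
        · simp [hp]
        have h2 : ℓ p ≤ -Real.log (hM.eigenvalues i) := by
          have := Real.log_le_log hi (hb _ _ (hev i) p hp)
          rw [Real.log_exp] at this
          linarith
        have h3 := mul_le_mul_of_nonneg_left h2
          (mul_nonneg hi.le (sq_nonneg ‖inner ℂ (b p) (hM.eigenvectorBasis i)‖))
        linarith
    _ = -(hM.eigenvalues i * Real.log (hM.eigenvalues i)) := by
        rw [← Finset.mul_sum, hn, mul_one]

end Entropy

/-! ### Reduced density matrices of invariant vectors -/

section Entanglement

variable {ι : Type} [Fintype ι] [DecidableEq ι] {S : Finset ι}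
  {eA : (j : ℕ) → Fin (spinMult (BlockA S) j) → Fin (2 * j + 1) → Qubits (BlockA S)}
  {eB : (j : ℕ) → Fin (spinMult (BlockB S) j) → Fin (2 * j + 1) → Qubits (BlockB S)}

theorem isHermitian_traceB (ψ : Qubits ι) : (traceB S (pureState ψ)).IsHermitian := by
  refine Matrix.IsHermitian.ext fun x x' => ?_
  simp only [traceB, Matrix.of_apply, pureState, Matrix.vecMulVec_apply, Pi.star_apply, star_sum,
    star_mul', star_star]
  exact Finset.sum_congr rfl fun y _ => mul_comm _ _

theorem inner_traceB_self (ψ : Qubits ι) (u : Qubits (BlockA S)) :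
    (inner ℂ u (Matrix.toEuclideanLin (traceB S (pureState ψ)) u)).re = ‖contract S ψ u‖ ^ 2 := by
  rw [inner_traceB, inner_self_eq_norm_sq_to_K]
  norm_cast

/-- The vector `⟨j,m,a|ψ⟩` of block `B`, for an invariant vector `ψ`. -/
theorem contract_eq_sum {ψ : Qubits ι} (hψ : ψ ∈ singletSpace ι) (hA : IsAngularMomentumBasis eA)
    (hB : IsAngularMomentumBasis eB) (j : ℕ) (a : Fin (spinMult (BlockA S) j))
    (μ : Fin (2 * j + 1)) :
    contract S ψ (eA j a μ) = ∑ b, ((-1 : ℂ) ^ ((μ.rev : Fin (2 * j + 1)) : ℕ) *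
      (((Real.sqrt (2 * (j : ℝ) + 1) : ℝ) : ℂ)⁻¹ * inner ℂ (singletVec eA eB ⟨j, a, b⟩) ψ)) •
        eB j b μ.rev := by
  refine hB.ext_inner fun j' b ν => ?_
  rw [← inner_prodVec_left, inner_sum]
  by_cases hj : j = j'
  · subst hj
    rw [coeff_eq_inner_singletVec hψ hA hB]
    split_ifs with hν
    · rw [Finset.sum_eq_single b, inner_smul_right, hν, hB.inner_eq_ite, if_pos rfl, mul_one]
      · intro b' _ hb
        rw [inner_smul_right, hB.inner_eq_zero (p := ⟨j, b, ν⟩) (q := ⟨j, b', μ.rev⟩), mul_zero]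
        intro h
        exact hb (Prod.mk.inj (eq_of_heq (Sigma.mk.inj h).2)).1.symm
      · simp
    · refine (Finset.sum_eq_zero fun b' _ => ?_).symm
      rw [inner_smul_right, hB.inner_eq_zero (p := ⟨j, b, ν⟩) (q := ⟨j, b', μ.rev⟩), mul_zero]
      intro h
      exact hν (Prod.mk.inj (eq_of_heq (Sigma.mk.inj h).2)).2
  · rw [coeff_of_ne hψ hA hB hj]
    refine (Finset.sum_eq_zero fun b' _ => ?_).symm
    rw [inner_smul_right, hB.inner_eq_zero (p := ⟨j', b, ν⟩) (q := ⟨j, b', μ.rev⟩), mul_zero]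
    intro h
    exact hj (Sigma.mk.inj h).1.symm

/-- The states `|j,-m,b⟩` are orthonormal in `b`, so the weight of `(j,a)` is spread evenly over the
`2j + 1` values of `m`. This is the source of the factor in the eigenvalue bound. -/
theorem norm_sq_contract {ψ : Qubits ι} (hψ : ψ ∈ singletSpace ι) (hA : IsAngularMomentumBasis eA)
    (hB : IsAngularMomentumBasis eB) (j : ℕ) (a : Fin (spinMult (BlockA S) j))
    (μ : Fin (2 * j + 1)) :
    ‖contract S ψ (eA j a μ)‖ ^ 2 =
      (2 * (j : ℝ) + 1)⁻¹ * ∑ b, ‖inner ℂ (singletVec eA eB ⟨j, a, b⟩) ψ‖ ^ 2 := by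
  have hon : Orthonormal ℂ fun b => eB j b μ.rev :=
    hB.orthonormal.comp (fun b => ⟨j, b, μ.rev⟩) fun b b' h => by simpa using h
  rw [contract_eq_sum hψ hA hB]
  set l : Fin (spinMult (BlockB S) j) → ℂ := fun b => (-1 : ℂ) ^ ((μ.rev : Fin (2 * j + 1)) : ℕ) *
    (((Real.sqrt (2 * (j : ℝ) + 1) : ℝ) : ℂ)⁻¹ * inner ℂ (singletVec eA eB ⟨j, a, b⟩) ψ)
  have h := hon.inner_sum l l Finset.univ
  rw [inner_self_eq_norm_sq_to_K] at h
  apply Complex.ofReal_injective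
  rw [Complex.ofReal_pow]
  refine h.trans ?_
  rw [Complex.ofReal_mul, Complex.ofReal_sum, Finset.mul_sum]
  refine Finset.sum_congr rfl fun b _ => ?_
  rw [Complex.conj_mul', ← Complex.ofReal_pow, ← Complex.ofReal_mul]
  congr 1
  simp only [l]
  rw [norm_mul, norm_mul, norm_pow, norm_neg, norm_one, one_pow, one_mul, norm_inv,
    Complex.norm_real, Real.norm_eq_abs, mul_pow, inv_pow, sq_abs,
    Real.sq_sqrt (by positivity)]

/-- Contraction with `|j,m,a⟩` lands in the sector `(j,-m)` of `B`, and distinct sectors are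
orthogonal. Through `inner_traceB`, the reduced matrix is block diagonal in `(j,m)`. -/
theorem inner_contract_eq_zero {ψ : Qubits ι} (hψ : ψ ∈ singletSpace ι)
    (hA : IsAngularMomentumBasis eA) (hB : IsAngularMomentumBasis eB) (j : ℕ)
    (a : Fin (spinMult (BlockA S) j)) (μ : Fin (2 * j + 1)) (p : SpinIndex (BlockA S))
    (hp : ∀ a', p ≠ ⟨j, a', μ⟩) :
    inner ℂ (contract S ψ (eA p.1 p.2.1 p.2.2)) (contract S ψ (eA j a μ)) = 0 := by
  rw [contract_eq_sum hψ hA hB j, inner_sum]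
  refine Finset.sum_eq_zero fun b _ => ?_
  rw [inner_smul_right, ← inner_conj_symm (contract S ψ _), ← inner_prodVec_left]
  obtain ⟨j', a', ν⟩ := p
  by_cases hj : j' = j
  · subst hj
    rw [coeff_eq_inner_singletVec hψ hA hB, if_neg, map_zero, mul_zero]
    intro h
    exact hp a' (by rw [Fin.rev_injective h])
  · rw [coeff_of_ne hψ hA hB hj, map_zero, mul_zero]

/-- The eigenvalues of the reduced density matrix of an invariant vector: an eigenvector with a
component of spin `j` has an eigenvalue at most `1 / (2j+1)`. -/
theorem eigenvalue_le {ψ : Qubits ι} (hψ : ψ ∈ singletSpace ι) (hψ1 : ‖ψ‖ = 1)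
    (hA : IsAngularMomentumBasis eA) (hB : IsAngularMomentumBasis eB) {φ : Qubits (BlockA S)}
    {r : ℝ} (hφ : Matrix.toEuclideanLin (traceB S (pureState ψ)) φ = (r : ℂ) • φ) {j : ℕ}
    {a : Fin (spinMult (BlockA S) j)} {μ : Fin (2 * j + 1)} (ha : inner ℂ (eA j a μ) φ ≠ 0) :
    r ≤ (2 * (j : ℝ) + 1)⁻¹ := by
  set f : Fin (spinMult (BlockA S) j) → ℂ := fun a => inner ℂ (eA j a μ) φ
  set T : Fin (spinMult (BlockA S) j) → Qubits (BlockB S) := fun a => contract S ψ (eA j a μ)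
  set F : ℝ := ∑ a, ‖f a‖ ^ 2 with hF
  have hFpos : 0 < F := by
    refine Finset.sum_pos' (fun _ _ => sq_nonneg _) ⟨a, Finset.mem_univ _, ?_⟩
    have : ‖f a‖ ≠ 0 := norm_ne_zero_iff.2 ha
    positivity
  -- The component of `φ` in the sector `(j,m)`, nonzero by `ha`. By block diagonality it satisfies
  -- the same eigenvalue equation, used here only in the quadratic form `r ‖φ'‖²`.
  set φ' : Qubits (BlockA S) := ∑ a, f a • eA j a μ with hφ'
  have hT' : contract S ψ φ' = ∑ a, star (f a) • T a := by
    rw [hφ', map_sum]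
    exact Finset.sum_congr rfl fun a _ => map_smulₛₗ _ _ _
  have h1 : inner ℂ φ' (Matrix.toEuclideanLin (traceB S (pureState ψ)) φ) = ((r * F : ℝ) : ℂ) := by
    rw [hφ, inner_smul_right, hφ', sum_inner, Complex.ofReal_mul, hF, Complex.ofReal_sum]
    congr 1
    refine Finset.sum_congr rfl fun a _ => ?_
    rw [inner_smul_left, Complex.ofReal_pow]
    exact Complex.conj_mul' (f a)
  have h2 : inner ℂ φ' (Matrix.toEuclideanLin (traceB S (pureState ψ)) φ) =
      ((‖contract S ψ φ'‖ ^ 2 : ℝ) : ℂ) := by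
    have h3 : ∀ a, inner ℂ (contract S ψ φ) (T a) = inner ℂ (contract S ψ φ') (T a) := by
      intro a
      rw [hT', sum_inner, ← hA.toBasis.sum_repr φ, map_sum, sum_inner]
      refine (Fintype.sum_of_injective (fun a' => (⟨j, a', μ⟩ : SpinIndex (BlockA S)))
        (fun a b h => by simpa using h) _ _ (fun p hp => ?_) fun a' => ?_).symm
      · rw [map_smulₛₗ, hA.toBasis_apply, inner_smul_left,
          inner_contract_eq_zero hψ hA hB j a μ p fun a' h => hp ⟨a', h.symm⟩, mul_zero]
      · rw [map_smulₛₗ, hA.toBasis_apply, OrthonormalBasis.repr_apply_apply, hA.toBasis_apply]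
        rfl
    rw [inner_traceB]
    nth_rewrite 1 [hT']
    rw [inner_sum]
    simp only [inner_smul_right, h3]
    simp only [← inner_smul_right]
    rw [← inner_sum, ← hT', inner_self_eq_norm_sq_to_K]
    norm_cast
  have h4 : r * F = ‖contract S ψ φ'‖ ^ 2 := Complex.ofReal_injective (h1.symm.trans h2)
  -- Cauchy–Schwarz: the top eigenvalue of the block is at most its trace.
  have h5 : ‖contract S ψ φ'‖ ^ 2 ≤ F * ∑ a, ‖T a‖ ^ 2 := by
    refine le_trans ?_ (Finset.sum_mul_sq_le_sq_mul_sq Finset.univ (fun a => ‖f a‖) fun a => ‖T a‖)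
    refine pow_le_pow_left₀ (norm_nonneg _) ?_ 2
    rw [hT']
    refine (norm_sum_le _ _).trans (Finset.sum_le_sum fun a _ => ?_)
    rw [norm_smul, norm_star]
  -- The trace of the block is the spin-`j` weight of `ψ` divided by `2j + 1`, and Bessel's
  -- inequality bounds that weight by `1`.
  have h6 : ∑ a, ‖T a‖ ^ 2 ≤ (2 * (j : ℝ) + 1)⁻¹ := by
    have hon : Orthonormal ℂ fun q : Fin (spinMult (BlockA S) j) × Fin (spinMult (BlockB S) j) =>
        singletVec eA eB ⟨j, q⟩ :=
      (orthonormal_singletVec hA hB).comp (fun q => ⟨j, q⟩) fun q q' h => by simpa using h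
    have h7 := hon.sum_inner_products_le ψ (s := Finset.univ)
    rw [hψ1, one_pow, Fintype.sum_prod_type] at h7
    simp only [T, norm_sq_contract hψ hA hB]
    rw [← Finset.mul_sum]
    exact mul_le_of_le_one_right (by positivity) h7
  have h8 : r * F ≤ (2 * (j : ℝ) + 1)⁻¹ * F := by
    rw [h4, mul_comm _ F]
    exact h5.trans (mul_le_mul_of_nonneg_left h6 hFpos.le)
  exact le_of_mul_le_mul_right h8 hFpos

theorem sum_singletIndex_eq (f : SingletIndex S → ℝ) {K : ℕ} (hK : Fintype.card (BlockA S) = 2 * K) :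
    ∑ p, f p = ∑ j ∈ Finset.range (K + 1), ∑ a, ∑ b, f ⟨j, a, b⟩ := by
  rw [sum_sigma_eq (K := K) fun j hj => by
    have := isEmpty_spinIndex hK hj
    infer_instance]
  exact Finset.sum_congr rfl fun j _ => Fintype.sum_prod_type _

theorem sum_spinIndex_eq (f : SpinIndex ι → ℝ) {K : ℕ} (hK : Fintype.card ι = 2 * K) :
    ∑ p, f p = ∑ j ∈ Finset.range (K + 1), ∑ a, ∑ μ, f ⟨j, a, μ⟩ := by
  rw [sum_sigma_eq (K := K) fun j hj => by
    have := isEmpty_spinIndex hK hj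
    infer_instance]
  exact Finset.sum_congr rfl fun j _ => Fintype.sum_prod_type _

/-- The entanglement of an invariant vector is at least the average of `log (2j+1)`. -/
theorem le_pureEntanglement {K : ℕ} (hK : Fintype.card (BlockA S) = 2 * K)
    (hA : IsAngularMomentumBasis eA) (hB : IsAngularMomentumBasis eB) {ψ : Qubits ι}
    (hψ : ψ ∈ singletSpace ι) (hψ1 : ‖ψ‖ = 1) :
    ∑ p : SingletIndex S, Real.log (2 * (p.1 : ℝ) + 1) * ‖inner ℂ (singletVec eA eB p) ψ‖ ^ 2 ≤
      pureEntanglement S ψ := by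
  have h := le_vonNeumannEntropy (isHermitian_traceB (S := S) ψ)
    (fun u => by rw [inner_traceB_self]; positivity) hA.toBasis
    (fun p => Real.log (2 * (p.1 : ℝ) + 1)) (fun φ r hφ p hp => by
      rw [Real.exp_neg, Real.exp_log (by positivity)]
      rw [hA.toBasis_apply] at hp
      exact eigenvalue_le hψ hψ1 hA hB hφ hp)
  refine le_trans (le_of_eq ?_) h
  rw [sum_singletIndex_eq _ hK, sum_spinIndex_eq _ hK]
  refine Finset.sum_congr rfl fun j _ => Finset.sum_congr rfl fun a _ => ?_
  simp only [hA.toBasis_apply, inner_traceB_self, norm_sq_contract hψ hA hB]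
  -- The `2j + 1` equal contributions of the values of `m` absorb the factor `(2j+1)⁻¹`.
  rw [Finset.sum_const, Finset.card_univ, Fintype.card_fin, ← Finset.mul_sum, nsmul_eq_mul]
  have : (2 * (j : ℝ) + 1) ≠ 0 := by positivity
  push_cast
  field_simp

/-- The reduced density matrix of a spin singlet. -/
theorem traceB_spinSinglet (hB : IsAngularMomentumBasis eB) (j : ℕ)
    (u : Fin (2 * j + 1) → Qubits (BlockA S)) (b : Fin (spinMult (BlockB S) j)) :
    traceB S (pureState (spinSinglet S j u (eB j b))) =
      (((2 * (j : ℝ) + 1)⁻¹ : ℝ) : ℂ) • ∑ μ, pureState (u μ) := by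
  ext x x'
  have h1 : ∀ x y, spinSinglet S j u (eB j b) (glue S (x, y)) =
      ((Real.sqrt (2 * (j : ℝ) + 1) : ℝ) : ℂ)⁻¹ *
        ∑ μ : Fin (2 * j + 1), (-1 : ℂ) ^ (μ : ℕ) * (u μ.rev x * eB j b μ y) := by
    intro x y
    rw [spinSinglet, PiLp.smul_apply, smul_eq_mul, WithLp.ofLp_sum, Finset.sum_apply]
    simp only [PiLp.smul_apply, smul_eq_mul, prodVec_apply_glue]
  have h2 : ∀ μ ν : Fin (2 * j + 1), ∑ y, eB j b μ y * star (eB j b ν y) =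
      if μ = ν then 1 else 0 := by
    intro μ ν
    rw [← ite_congr (propext eq_comm) (fun _ => rfl) fun _ => rfl, ← hB.inner_eq_ite j b ν μ,
      PiLp.inner_apply]
    rfl
  have hc : (((2 * (j : ℝ) + 1)⁻¹ : ℝ) : ℂ) = ((Real.sqrt (2 * (j : ℝ) + 1) : ℝ) : ℂ)⁻¹ *
      ((Real.sqrt (2 * (j : ℝ) + 1) : ℝ) : ℂ)⁻¹ := by
    rw [← mul_inv, sqrt_two_mul_add_one_mul_self]
    push_cast
    rfl
  have hstar : star ((Real.sqrt (2 * (j : ℝ) + 1) : ℝ) : ℂ)⁻¹ =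
      ((Real.sqrt (2 * (j : ℝ) + 1) : ℝ) : ℂ)⁻¹ := by
    rw [star_inv₀, Complex.star_def, Complex.conj_ofReal]
  have hstar1 : ∀ μ : ℕ, star ((-1 : ℂ) ^ μ) = (-1) ^ μ := fun μ => by simp
  have hsign : ∀ μ : ℕ, (-1 : ℂ) ^ μ * (-1) ^ μ = 1 := fun μ => by simp [← mul_pow]
  rw [Matrix.smul_apply, Matrix.sum_apply, smul_eq_mul]
  simp only [traceB, Matrix.of_apply, pureState, Matrix.vecMulVec_apply, Pi.star_apply, h1,
    star_mul', star_sum, hstar, hstar1]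
  rw [hc, ← Equiv.sum_comp Fin.revPerm fun μ => u μ x * star (u μ x')]
  simp only [Fin.revPerm_apply]
  calc _ = ∑ y, (((Real.sqrt (2 * (j : ℝ) + 1) : ℝ) : ℂ)⁻¹ *
        ((Real.sqrt (2 * (j : ℝ) + 1) : ℝ) : ℂ)⁻¹) * ∑ μ : Fin (2 * j + 1),
          ∑ ν : Fin (2 * j + 1), ((-1 : ℂ) ^ (μ : ℕ) * (-1) ^ (ν : ℕ) *
            (u μ.rev x * star (u ν.rev x'))) * (eB j b μ y * star (eB j b ν y)) := by
        refine Finset.sum_congr rfl fun y _ => ?_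
        rw [mul_mul_mul_comm, Finset.sum_mul_sum]
        congr 1
        refine Finset.sum_congr rfl fun μ _ => Finset.sum_congr rfl fun ν _ => ?_
        ring
    _ = _ := by
        rw [← Finset.mul_sum]
        congr 1
        rw [Finset.sum_comm]
        refine Finset.sum_congr rfl fun μ _ => ?_
        rw [Finset.sum_comm]
        -- Orthonormality in block `B` kills the cross terms; the signs on the diagonal square to
        -- `1`.
        simp only [← Finset.mul_sum, h2]
        simp [hsign]

theorem pureState_mul_pureState (u v : Qubits ι) :
    pureState u * pureState v = (inner ℂ u v : ℂ) • Matrix.vecMulVec (WithLp.ofLp u)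
      (star (WithLp.ofLp v)) := by
  rw [pureState, pureState, Matrix.vecMulVec_mul_vecMulVec, Matrix.vecMulVec_smul]
  congr 1
  rw [PiLp.inner_apply, dotProduct]
  refine Finset.sum_congr rfl fun x _ => ?_
  rw [RCLike.inner_apply, Pi.star_apply, starRingEnd_apply, mul_comm]

theorem trace_pureState (u : Qubits ι) : (pureState u).trace = ((‖u‖ ^ 2 : ℝ) : ℂ) := by
  have : (pureState u).trace = inner ℂ u u := by
    rw [PiLp.inner_apply, Matrix.trace]
    rfl
  rw [this, inner_self_eq_norm_sq_to_K, Complex.ofReal_pow]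
  rfl

theorem isHermitian_pureState (u : Qubits ι) : (pureState u).IsHermitian := by
  refine Matrix.IsHermitian.ext fun x x' => ?_
  simp only [pureState, Matrix.vecMulVec_apply, Pi.star_apply, star_mul', star_star]
  exact mul_comm _ _

theorem vonNeumannEntropy_multiplet
    {e : (j : ℕ) → Fin (spinMult ι j) → Fin (2 * j + 1) → Qubits ι}
    (he : IsAngularMomentumBasis e) (j : ℕ) (a : Fin (spinMult ι j)) :
    vonNeumannEntropy ((((2 * (j : ℝ) + 1)⁻¹ : ℝ) : ℂ) • ∑ μ, pureState (e j a μ)) =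
      Real.log (2 * (j : ℝ) + 1) := by
  rw [vonNeumannEntropy_of_sq (c := (2 * (j : ℝ) + 1)⁻¹), Real.log_inv, neg_neg]
  · rw [Matrix.IsHermitian, Matrix.conjTranspose_smul, Matrix.conjTranspose_sum, Complex.star_def,
      Complex.conj_ofReal]
    congr 1
    exact Finset.sum_congr rfl fun μ _ => isHermitian_pureState _
  · rw [smul_mul_smul_comm, smul_smul, Finset.sum_mul_sum]
    congr 1
    refine Finset.sum_congr rfl fun μ _ => ?_
    simp only [pureState_mul_pureState, he.inner_eq_ite, ite_smul, one_smul, zero_smul,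
      Finset.sum_ite_eq, Finset.mem_univ, if_true]
    rfl
  · rw [Matrix.trace_smul, Matrix.trace_sum]
    simp only [trace_pureState, he.norm_eq_one, one_pow, Finset.sum_const, Finset.card_univ,
      Fintype.card_fin, nsmul_eq_mul, Complex.ofReal_one, mul_one, smul_eq_mul]
    push_cast
    exact inv_mul_cancel₀ (two_mul_add_one_ne_zero j)

theorem pureEntanglement_singletVec (hA : IsAngularMomentumBasis eA)
    (hB : IsAngularMomentumBasis eB) (p : SingletIndex S) :
    pureEntanglement S (singletVec eA eB p) = Real.log (2 * (p.1 : ℝ) + 1) := by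
  rw [pureEntanglement, singletVec, traceB_spinSinglet hB, vonNeumannEntropy_multiplet hA]

end Entanglement

/-! ### A nonzero invariant vector, so that `N > 0` -/

section ProductSinglet

/-- Configurations of `2n` qubits as families of configurations of `n` pairs. -/
def pairEquiv (n : ℕ) : (Fin n → Fin 2 → Fin 2) ≃ (Fin (2 * n) → Fin 2) where
  toFun z k := z (finProdFinEquiv.symm k).2 (finProdFinEquiv.symm k).1
  invFun y i c := y (finProdFinEquiv (c, i))
  left_inv z := by
    ext i c
    simp only [Equiv.symm_apply_apply]
  right_inv y := funext fun k => congr_arg y (finProdFinEquiv.apply_symm_apply k)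

theorem pairEquiv_apply (n : ℕ) (z : Fin n → Fin 2 → Fin 2) (c : Fin 2) (i : Fin n) :
    pairEquiv n z (finProdFinEquiv (c, i)) = z i c := by
  simp only [pairEquiv, Equiv.coe_fn_mk, Equiv.symm_apply_apply]

/-- The product of `n` two-qubit singlets. -/
def productSinglet (n : ℕ) : Qubits (Fin (2 * n)) :=
  WithLp.toLp 2 fun x => ∏ i : Fin n, (!![0, 1; -1, 0] : Matrix (Fin 2) (Fin 2) ℂ)
    (x (finProdFinEquiv (0, i))) (x (finProdFinEquiv (1, i)))

theorem productSinglet_apply (n : ℕ) (x : Fin (2 * n) → Fin 2) :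
    productSinglet n x = ∏ i : Fin n, (!![0, 1; -1, 0] : Matrix (Fin 2) (Fin 2) ℂ)
      (x (finProdFinEquiv (0, i))) (x (finProdFinEquiv (1, i))) := rfl

/-- The sum over configurations factors over the pairs, and on each pair `U ε Uᵀ = (det U) ε = ε`.
-/
theorem productSinglet_mem (n : ℕ) : productSinglet n ∈ singletSpace (Fin (2 * n)) := by
  intro g
  obtain ⟨U, hU⟩ := g
  have hdet := (Matrix.mem_specialUnitaryGroup_iff.1 hU).2
  rw [Matrix.det_fin_two] at hdet
  ext x
  change tensorPowLin (Fin (2 * n)) U (productSinglet n) x = productSinglet n x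
  rw [tensorPowLin_apply, ← (pairEquiv n).sum_comp, productSinglet_apply]
  have h1 : ∀ z : Fin n → Fin 2 → Fin 2,
      (∏ k, U (x k) (pairEquiv n z k)) * productSinglet n (pairEquiv n z) =
      ∏ i : Fin n, (U (x (finProdFinEquiv (0, i))) (z i 0) *
        U (x (finProdFinEquiv (1, i))) (z i 1) *
        (!![0, 1; -1, 0] : Matrix (Fin 2) (Fin 2) ℂ) (z i 0) (z i 1)) := by
    intro z
    rw [Finset.prod_mul_distrib, Finset.prod_mul_distrib, ← finProdFinEquiv.prod_comp,
      Fintype.prod_prod_type, Fin.prod_univ_two, productSinglet_apply]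
    simp only [pairEquiv_apply]
  simp only [h1]
  have h2 := Finset.prod_univ_sum (fun _ : Fin n => (Finset.univ : Finset (Fin 2 → Fin 2)))
    fun i w => U (x (finProdFinEquiv (0, i))) (w 0) * U (x (finProdFinEquiv (1, i))) (w 1) *
        (!![0, 1; -1, 0] : Matrix (Fin 2) (Fin 2) ℂ) (w 0) (w 1)
  rw [Fintype.piFinset_univ] at h2
  rw [← h2]
  refine Finset.prod_congr rfl fun i _ => ?_
  generalize x (finProdFinEquiv (0, i)) = c
  generalize x (finProdFinEquiv (1, i)) = d
  rw [← (finTwoArrowEquiv (Fin 2)).symm.sum_comp, Fintype.sum_prod_type]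
  simp only [Fin.sum_univ_two, finTwoArrowEquiv_symm_apply, Matrix.cons_val_zero,
    Matrix.cons_val_one, Matrix.of_apply, Matrix.cons_val', Matrix.cons_val_fin_one]
  fin_cases c <;> fin_cases d <;> simp
  · ring
  · linear_combination hdet
  · linear_combination -hdet
  · ring

theorem finrank_singletSpace_pos (n : ℕ) :
    0 < Module.finrank ℂ (singletSpace (Fin (2 * n))) := by
  have hne : productSinglet n ≠ 0 := by
    intro h
    -- In the configuration where every pair reads `(0, 1)`, all the factors are `1`.
    have h1 : productSinglet n (pairEquiv n fun _ c => c) = 0 := by rw [h]; rfl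
    rw [productSinglet_apply] at h1
    simp [pairEquiv_apply] at h1
  have : Nontrivial (singletSpace (Fin (2 * n))) :=
    ⟨⟨productSinglet n, productSinglet_mem n⟩, 0, fun h => hne (congr_arg Subtype.val h)⟩
  exact Module.finrank_pos

end ProductSinglet

/-! ### Decompositions of the maximally mixed invariant state -/

section Formation

variable {ι : Type} [Fintype ι] [DecidableEq ι] {S : Finset ι}
  {eA : (j : ℕ) → Fin (spinMult (BlockA S) j) → Fin (2 * j + 1) → Qubits (BlockA S)}
  {eB : (j : ℕ) → Fin (spinMult (BlockB S) j) → Fin (2 * j + 1) → Qubits (BlockB S)}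

theorem inner_pureState (ψ v : Qubits ι) :
    inner ℂ v (Matrix.toEuclideanLin (pureState ψ) v) = ((‖inner ℂ v ψ‖ ^ 2 : ℝ) : ℂ) := by
  have h : Matrix.toEuclideanLin (pureState ψ) v = (inner ℂ ψ v : ℂ) • ψ := by
    ext x
    change ∑ y, (ψ x * star (ψ y)) * v y = _
    rw [PiLp.smul_apply, PiLp.inner_apply, smul_eq_mul, Finset.sum_mul]
    refine Finset.sum_congr rfl fun y _ => ?_
    rw [RCLike.inner_apply, starRingEnd_apply]
    ring
  rw [h, inner_smul_right, ← inner_conj_symm, Complex.conj_mul', Complex.ofReal_pow]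

/-- The weights of the vectors of a decomposition of the maximally mixed invariant state. -/
theorem sum_weights {r : ℕ} {w : Fin r → ℝ} {ψ : Fin r → Qubits ι}
    (h : singletState ι = ∑ i, (w i : ℂ) • pureState (ψ i)) (v : Qubits ι) :
    ((∑ i, w i * ‖inner ℂ v (ψ i)‖ ^ 2 : ℝ) : ℂ) =
      ((Module.finrank ℂ (singletSpace ι) : ℂ))⁻¹ *
        inner ℂ v ((singletSpace ι).starProjection v) := by
  have h1 : inner ℂ v (Matrix.toEuclideanLin (singletState ι) v) =
      ((Module.finrank ℂ (singletSpace ι) : ℂ))⁻¹ *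
        inner ℂ v ((singletSpace ι).starProjection v) := by
    rw [singletState, map_smul, LinearEquiv.apply_symm_apply, LinearMap.smul_apply,
      inner_smul_right]
    rfl
  rw [← h1, h, map_sum, LinearMap.sum_apply, inner_sum, Complex.ofReal_sum]
  refine Finset.sum_congr rfl fun i _ => ?_
  rw [map_smul, LinearMap.smul_apply, inner_smul_right, inner_pureState, Complex.ofReal_mul]

/-- For `v` orthogonal to the invariants, `0 = ⟨v|ρ|v⟩ = ∑ w_i |⟨v|ψ_i⟩|²`; the weights are
positive, so every term vanishes. -/
theorem mem_singletSpace_of_decomposition {r : ℕ} {w : Fin r → ℝ} {ψ : Fin r → Qubits ι}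
    (hw : ∀ i, 0 < w i) (h : singletState ι = ∑ i, (w i : ℂ) • pureState (ψ i)) (i : Fin r) :
    ψ i ∈ singletSpace ι := by
  rw [← (singletSpace ι).orthogonal_orthogonal, Submodule.mem_orthogonal]
  intro v hv
  have h1 := sum_weights h v
  rw [(singletSpace ι).starProjection_apply_eq_zero_iff.2 hv, inner_zero_right, mul_zero,
    Complex.ofReal_eq_zero, Finset.sum_eq_zero_iff_of_nonneg
      fun i _ => mul_nonneg (hw i).le (sq_nonneg _)] at h1
  simpa [(hw i).ne'] using h1 i (Finset.mem_univ i)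

/-- The least average entanglement is the average of `log (2j+1)` over the spin singlets. -/
theorem isLeast_averageEntanglements {K : ℕ} (hK : Fintype.card (BlockA S) = 2 * K)
    (hN : 0 < Module.finrank ℂ (singletSpace ι)) (hA : IsAngularMomentumBasis eA)
    (hB : IsAngularMomentumBasis eB) :
    IsLeast (averageEntanglements S (singletState ι))
      (1 / (Module.finrank ℂ (singletSpace ι) : ℝ) *
        ∑ p : SingletIndex S, Real.log (2 * (p.1 : ℝ) + 1)) := by
  have hNR : (0 : ℝ) < Module.finrank ℂ (singletSpace ι) := by exact_mod_cast hN
  constructor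
  · let σ := (Fintype.equivFin (SingletIndex S)).symm
    refine ⟨Fintype.card (SingletIndex S), fun _ => 1 / (Module.finrank ℂ (singletSpace ι) : ℝ),
      fun i => singletVec eA eB (σ i), fun _ => by positivity, ?_, fun i =>
      (orthonormal_singletVec hA hB).1 _, ?_, ?_⟩
    · rw [Finset.sum_const, Finset.card_univ, Fintype.card_fin, card_singletIndex hA hB,
        nsmul_eq_mul]
      field_simp
    · rw [singletState_eq_sum hA hB, ← σ.sum_comp, Finset.smul_sum]
      push_cast
      rw [one_div]
    · rw [← Finset.mul_sum, ← σ.sum_comp]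
      simp only [pureEntanglement_singletVec hA hB]
  · rintro t ⟨r, w, ψ, hw, -, hψ1, hρ, rfl⟩
    have hmem := mem_singletSpace_of_decomposition hw hρ
    -- The left side is the expectation of `ρ` in a spin singlet, whatever the decomposition; this
    -- makes the averaged lower bound universal.
    have hweight : ∀ p : SingletIndex S, ∑ i, w i * ‖inner ℂ (singletVec eA eB p) (ψ i)‖ ^ 2 =
        1 / (Module.finrank ℂ (singletSpace ι) : ℝ) := by
      intro p
      have h1 := sum_weights hρ (singletVec eA eB p)
      rw [Submodule.starProjection_eq_self_iff.2 (singletVec_mem hA hB p),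
        inner_self_eq_norm_sq_to_K, (orthonormal_singletVec hA hB).1] at h1
      apply Complex.ofReal_injective
      rw [h1]
      simp
    calc 1 / (Module.finrank ℂ (singletSpace ι) : ℝ) *
          ∑ p : SingletIndex S, Real.log (2 * (p.1 : ℝ) + 1)
        = ∑ i, w i * ∑ p : SingletIndex S, Real.log (2 * (p.1 : ℝ) + 1) *
            ‖inner ℂ (singletVec eA eB p) (ψ i)‖ ^ 2 := by
          simp only [Finset.mul_sum]
          rw [Finset.sum_comm]
          refine Finset.sum_congr rfl fun p _ => ?_
          rw [← hweight p, Finset.sum_mul]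
          exact Finset.sum_congr rfl fun i _ => by ring
      _ ≤ ∑ i, w i * pureEntanglement S (ψ i) :=
          Finset.sum_le_sum fun i _ => mul_le_mul_of_nonneg_left
            (le_pureEntanglement hK hA hB (hmem i) (hψ1 i)) (hw i).le

end Formation
end

/-! ### The entanglement of formation -/

theorem proposition2 (n k : ℕ) (S : Finset (Fin (2 * n))) (hS : S.card = 2 * k) :
    -- the minimum over all pure-state decompositions is attained
    IsLeast (averageEntanglements S (singletState (Fin (2 * n))))
      (entanglementOfFormation S (singletState (Fin (2 * n)))) ∧
    -- the exact value
    entanglementOfFormation S (singletState (Fin (2 * n))) =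
      1 / (Module.finrank ℂ (singletSpace (Fin (2 * n))) : ℝ) *
        ∑ j ∈ Finset.range (k + 1),
          (spinMult (BlockA S) j : ℝ) * (spinMult (BlockB S) j : ℝ) * Real.log (2 * (j : ℝ) + 1) ∧
    -- angular momentum bases of the two blocks exist
    (∃ eA : (j : ℕ) → Fin (spinMult (BlockA S) j) → Fin (2 * j + 1) → Qubits (BlockA S),
      IsAngularMomentumBasis eA) ∧
    (∃ eB : (j : ℕ) → Fin (spinMult (BlockB S) j) → Fin (2 * j + 1) → Qubits (BlockB S),
      IsAngularMomentumBasis eB) ∧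
    -- for any such bases, the reduced density matrix of `|j,a,b⟩` depends on `j, a` only,
    -- and the entanglement is the average of the entropies of these matrices
    ∀ (eA : (j : ℕ) → Fin (spinMult (BlockA S) j) → Fin (2 * j + 1) → Qubits (BlockA S))
      (eB : (j : ℕ) → Fin (spinMult (BlockB S) j) → Fin (2 * j + 1) → Qubits (BlockB S)),
      IsAngularMomentumBasis eA → IsAngularMomentumBasis eB →
      ∃ R : (j : ℕ) → Fin (spinMult (BlockA S) j) →
          Matrix (BlockA S → Fin 2) (BlockA S → Fin 2) ℂ,
        (∀ (j : ℕ) (a : Fin (spinMult (BlockA S) j)) (b : Fin (spinMult (BlockB S) j)),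
          traceB S (pureState (spinSinglet S j (eA j a) (eB j b))) = R j a) ∧
        entanglementOfFormation S (singletState (Fin (2 * n))) =
          1 / (Module.finrank ℂ (singletSpace (Fin (2 * n))) : ℝ) *
            ∑ j ∈ Finset.range (k + 1), ∑ a : Fin (spinMult (BlockA S) j),
              (spinMult (BlockB S) j : ℝ) * vonNeumannEntropy (R j a) := by
  have hcA : Fintype.card (BlockA S) = 2 * k := by rw [Fintype.card_coe, hS]
  have hcB : Fintype.card (BlockB S) = 2 * (n - k) := by
    rw [Fintype.card_subtype_compl, Fintype.card_fin, Fintype.card_coe, hS, Nat.mul_sub]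
  obtain ⟨eA, hA⟩ := exists_isAngularMomentumBasis hcA
  obtain ⟨eB, hB⟩ := exists_isAngularMomentumBasis hcB
  have hleast := isLeast_averageEntanglements hcA (finrank_singletSpace_pos n) hA hB
  have hval : entanglementOfFormation S (singletState (Fin (2 * n))) = _ := hleast.csInf_eq
  have hsum : entanglementOfFormation S (singletState (Fin (2 * n))) =
      1 / (Module.finrank ℂ (singletSpace (Fin (2 * n))) : ℝ) *
        ∑ j ∈ Finset.range (k + 1), (spinMult (BlockA S) j : ℝ) *
          (spinMult (BlockB S) j : ℝ) * Real.log (2 * (j : ℝ) + 1) := by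
    rw [hval, sum_singletIndex_eq _ hcA]
    congr 1
    refine Finset.sum_congr rfl fun j _ => ?_
    simp [mul_assoc]
  refine ⟨hval ▸ hleast, hsum, ⟨eA, hA⟩, ⟨eB, hB⟩, fun eA eB hA hB => ?_⟩
  -- The maximally mixed state of the multiplet makes sense even when `B` has no copy of spin `j`.
  -- The value `hsum` mentions no basis, so for arbitrary bases only the entropy of this matrix
  -- remains to be inserted.
  refine ⟨fun j a => (((2 * (j : ℝ) + 1)⁻¹ : ℝ) : ℂ) • ∑ μ, pureState (eA j a μ),
    fun j a b => traceB_spinSinglet hB j (eA j a) b, ?_⟩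
  rw [hsum]
  congr 1
  refine Finset.sum_congr rfl fun j _ => ?_
  simp only [vonNeumannEntropy_multiplet hA]
  simp [mul_assoc]
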